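/- For $n\in\mathbb N$ and $\lambda\ge 0$ let $$q_n(\lambda)=\sup_{x>0}\frac{n!}{x^n}\left|e^{ix}-\sum_{k=0}^{n-1}\frac{(ix)^k}{k!}-\lambda\frac{(ix)^n}{n!}\right|,$$ $$\lambda_*(n)=\sup\Big\{\lambda\ge0:\ \sup_{0\le s\le\lambda}(s+q_n(s))=1\Big\},\qquad \lambda^*(n)=\inf\Big\{\lambda\ge0:\ q_n(\lambda)=\inf_{s\ge0}q_n(s)\Big\}.$$ For $b\ge1$ let $$A(b)=\sqrt{\tfrac12\sqrt{1+8b^{-2}}+\tfrac12-2b^{-2}},\qquad \gamma_n(b)=\min_{\lambda_*(n)\le\lambda\le\lambda^*(n)}\big(\lambda A(b)+q_n(\lambda)\big),\quad n=1,2,3,$$ where the minimum is attained, and let $\theta_1^*$ be the unique root of $\theta\sin\theta+\cos\theta-1=0$ in $(0,\pi)$ (which exists). For all $b\ge1$ and every real random variable $X$ with $\mathsf E X=0$, $\mathsf E X^2=1$, $\mathsf E|X|^3=b$, the characteristic function $f(t)=\mathsf E e^{itX}$ is twice differentiable, and for all $t\in\mathbb R$ $$\left|f(t)-1+\frac{t^2}{2}\right|\le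 b\gamma_3(b)\frac{|t|^3}{6},\qquad |f'(t)+t|\le b\gamma_2(b)\frac{t^2}{2},\qquad |f''(t)+1|\le b\gamma_1(b)|t|,$$ $$|f(t)-1|\le\frac{1-\cos\theta_1^*}{\theta_1^*}\,\mathsf E|tX|\le 0.7247\,|t|\,\mathsf E|X|.$$ Moreover, for $n=1,2,3$ the functions $\gamma_n(b)$ and $b\gamma_n(b)$ are concave and strictly increasing in $b\ge1$, and $$q_n(\lambda^*(n))=\gamma_n(1)\le\gamma_n(b)<\lim_{b\to\infty}\gamma_n(b)=1,\qquad b\ge1.$$ -/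

import Mathlib

/-- The function `A(b) = √(½ √(1 + 8 b⁻²) + ½ - 2 b⁻²)`. -/
noncomputable def momentA (b : ℝ) : ℝ :=
  Real.sqrt (1 / 2 * Real.sqrt (1 + 8 / b ^ 2) + 1 / 2 - 2 / b ^ 2)

/-- `q_n(lam) = sup_{x > 0} (n! / xⁿ) |e^{ix} - ∑_{k < n} (ix)^k / k! - lam (ix)^n / n!|`. The
supremum is over a non-empty set, bounded (for `n ≥ 1`) because `|e^{ix} - ∑_{k < n} (ix)^k / k!|`
is at most `xⁿ / n!`. -/
noncomputable def qFun (n : ℕ) (lam : ℝ) : ℝ :=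
  sSup ((fun x : ℝ => (n.factorial : ℝ) / x ^ n *
    ‖Complex.exp (Complex.I * x)
      - ∑ k ∈ Finset.range n, (Complex.I * x) ^ k / (k.factorial : ℂ)
      - (lam : ℂ) * ((Complex.I * x) ^ n / (n.factorial : ℂ))‖) '' Set.Ioi 0)

/-- `lam_*(n) = sup {lam ≥ 0 : sup_{0 ≤ s ≤ lam} (s + q_n(s)) = 1}`. -/
noncomputable def lamLower (n : ℕ) : ℝ :=
  sSup {lam : ℝ | 0 ≤ lam ∧ sSup ((fun s : ℝ => s + qFun n s) '' Set.Icc 0 lam) = 1}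

/-- `lam^*(n) = inf {lam ≥ 0 : q_n(lam) = inf_{s ≥ 0} q_n(s)}`. -/
noncomputable def lamUpper (n : ℕ) : ℝ :=
  sInf {lam : ℝ | 0 ≤ lam ∧ qFun n lam = sInf (qFun n '' Set.Ici 0)}

/-- `γ_n(b)`, the minimum of `lam * A(b) + q_n(lam)` over `lam_*(n) ≤ lam ≤ lam^*(n)`, written as
an infimum. -/
noncomputable def gammaFun (n : ℕ) (b : ℝ) : ℝ :=
  sInf ((fun lam : ℝ => lam * momentA b + qFun n lam) '' Set.Icc (lamLower n) (lamUpper n))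

/-- `θ` is a root of `θ sin θ + cos θ - 1 = 0` in `(0, π)`. -/
def IsThetaOne (θ : ℝ) : Prop :=
  θ ∈ Set.Ioo 0 Real.pi ∧ θ * Real.sin θ + Real.cos θ - 1 = 0

/-! ### The function `momentA` -/

/-! For every real λ the `n`-th Taylor remainder of `e^{itx}` is the remainder with the top term
weighted by λ, plus `λ (itx)^n / n!`. Multiply by `x^m` with `m + n = 3` and integrate. The weighted
remainder contributes at most `q_n(λ) b |t|^n / n!` by the definition of `q_n`; for λ ≥ 0 the extra
term contributes at most `λ |E X³| |t|^n / n!`. Since `|E X³| ≤ b A(b)`, the total is `b (λ A(b) +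
q_n(λ)) |t|^n / n!`, and minimising over λ gives `b γ_n(b)`. The cases `n = 3, 2, 1` bound `f`,
`f'`, `f''`, whose deviations from `1 - t²/2`, `-t`, `-1` are such integrals up to a unimodular
factor.

The moment bound (`integral_cube_le`) is a duality argument: a cubic inequality with equality on
both atoms of a two-point law is integrated. For these laws the third absolute moment is an
increasing convex function of the third moment `w ≥ 0`, and `b A(b)` is its inverse, hence concave.

In each `γ_n(b)` the minimising λ is positive, so `γ_n` and `b γ_n` inherit concavity and strict
growth from `A` and `b A`. The values at the ends come from `A(1) = 0`, `A(b) → 1`, the bound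
`q_n(λ) ≥ 1 - λ`, and equality there for `0 ≤ λ ≤ 1/4`.

For `|f - 1|` the mean is zero, so any multiple of `itX` may be subtracted for free. The choice `λ =
1 + cos θ₁*` gives `|e^{ix} - 1 - iλx| ≤ sin θ₁* |x|`, and `sin θ₁* = (1 - cos θ₁*) / θ₁*`. -/

theorem sqrt_add_sq_convex {c : ℝ} (hc : 0 ≤ c) :
    ConvexOn ℝ Set.univ (fun y : ℝ => √(c + y ^ 2)) := by
  refine ⟨convex_univ, fun x _ y _ a b ha hb hab => ?_⟩
  simp only [smul_eq_mul]
  have hx : 0 ≤ c + x ^ 2 := by positivity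
  have hy : 0 ≤ c + y ^ 2 := by positivity
  have hxy : c + x * y ≤ √(c + x ^ 2) * √(c + y ^ 2) := by
    rw [← Real.sqrt_mul hx]
    refine Real.le_sqrt_of_sq_le ?_
    nlinarith [mul_nonneg hc (sq_nonneg (x - y))]
  rw [Real.sqrt_le_left (by positivity)]
  obtain rfl : b = 1 - a := by linarith
  have e : (a * √(c + x ^ 2) + (1 - a) * √(c + y ^ 2)) ^ 2 - (c + (a * x + (1 - a) * y) ^ 2) =
      2 * (a * (1 - a) * (√(c + x ^ 2) * √(c + y ^ 2)) - a * (1 - a) * (c + x * y)) := by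
    linear_combination a ^ 2 * Real.sq_sqrt hx + (1 - a) ^ 2 * Real.sq_sqrt hy
  linarith [mul_le_mul_of_nonneg_left hxy (mul_nonneg ha hb)]

/-- The third absolute moment of the centred, normalised two-point law with third moment `w`. -/
noncomputable def twoPointAbsMoment (w : ℝ) : ℝ := √(w ^ 2 + 4) - 2 / √(w ^ 2 + 4)

/-- The law lives on `a` and `-1/a`, with masses `1/(1+a²)` and `a²/(1+a²)`. Then `w = a - 1/a`,
`√(w² + 4) = a + 1/a =: z`, and the third absolute moment is `z - 2/z`, which increases with `z`. -/
theorem twoPointAbsMoment_lt {v w : ℝ} (hv : 0 ≤ v) (h : v < w) :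
    twoPointAbsMoment v < twoPointAbsMoment w := by
  have h1 : √(v ^ 2 + 4) < √(w ^ 2 + 4) := Real.sqrt_lt_sqrt (by positivity) (by nlinarith)
  have h2 : 0 < √(v ^ 2 + 4) := Real.sqrt_pos.2 (by positivity)
  have h3 : 2 / √(w ^ 2 + 4) < 2 / √(v ^ 2 + 4) := div_lt_div_of_pos_left two_pos h2 h1
  unfold twoPointAbsMoment
  linarith

theorem le_of_twoPointAbsMoment_le {v w : ℝ} (hw : 0 ≤ w)
    (h : twoPointAbsMoment v ≤ twoPointAbsMoment w) : v ≤ w := by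
  by_contra! hlt
  exact absurd (twoPointAbsMoment_lt hw hlt) (not_lt.2 h)

theorem twoPointAbsMoment_convex : ConvexOn ℝ Set.univ twoPointAbsMoment := by
  have hp : ∀ w : ℝ, 0 < √(w ^ 2 + 4) := fun w => Real.sqrt_pos.2 (by positivity)
  have hsq : ∀ w : ℝ, √(w ^ 2 + 4) ^ 2 = w ^ 2 + 4 := fun w => Real.sq_sqrt (by positivity)
  have hz : ∀ w : ℝ, HasDerivAt (fun w : ℝ => √(w ^ 2 + 4)) (w / √(w ^ 2 + 4)) w := by
    intro w
    have := (((hasDerivAt_id w).pow 2).add_const (4 : ℝ)).sqrt (by simp; positivity)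
    convert! this using 1
    simp
    field_simp
  have h1 : ∀ w : ℝ, HasDerivAt twoPointAbsMoment
      (w / √(w ^ 2 + 4) + 2 * w / √(w ^ 2 + 4) ^ 3) w := by
    intro w
    have := (hz w).sub ((hasDerivAt_const w (2 : ℝ)).div (hz w) (hp w).ne')
    convert! this using 1
    have := (hp w).ne'
    field_simp
    ring
  have h2 : ∀ w : ℝ, HasDerivAt (fun w : ℝ => w / √(w ^ 2 + 4) + 2 * w / √(w ^ 2 + 4) ^ 3)
      (24 / √(w ^ 2 + 4) ^ 5) w := by
    intro w
    have := ((hasDerivAt_id w).div (hz w) (hp w).ne').add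
      (((hasDerivAt_id w).const_mul (2 : ℝ)).div ((hz w).pow 3) (pow_pos (hp w) 3).ne')
    convert! this using 1
    have := (hp w).ne'
    have hs := hsq w
    simp only [id, Pi.pow_apply]
    generalize √(w ^ 2 + 4) = z at *
    field_simp
    push_cast
    ring_nf
    linear_combination -(6 * z ^ 2 + z ^ 4) * hs
  have hd1 : deriv twoPointAbsMoment = _ := funext fun w => (h1 w).deriv
  refine convexOn_of_deriv2_nonneg' convex_univ (fun w _ => (h1 w).differentiableAt.differentiableWithinAt) ?_ ?_
  · rw [hd1]; exact fun w _ => (h2 w).differentiableAt.differentiableWithinAt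
  · intro w _
    simp only [Function.iterate_succ, Function.iterate_zero, Function.comp, id]
    rw [hd1, (h2 w).deriv]
    have := hp w
    positivity

theorem momentA_nonneg (b : ℝ) : 0 ≤ momentA b := Real.sqrt_nonneg _

theorem one_lt_sqrt_one_add {b : ℝ} (hb : 1 ≤ b) : 1 < √(1 + 8 / b ^ 2) := by
  rw [Real.lt_sqrt one_pos.le]
  have : 0 < 8 / b ^ 2 := by positivity
  linarith

theorem sqrt_one_add_le {b : ℝ} (hb : 1 ≤ b) : √(1 + 8 / b ^ 2) ≤ 3 := by
  rw [Real.sqrt_le_left (by norm_num)]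
  have : 8 / b ^ 2 ≤ 8 := div_le_self (by norm_num) (one_le_pow₀ hb)
  linarith

theorem sqrt_one_add_lt {b c : ℝ} (hb : 1 ≤ b) (hbc : b < c) :
    √(1 + 8 / c ^ 2) < √(1 + 8 / b ^ 2) := by
  have : 8 / c ^ 2 < 8 / b ^ 2 :=
    div_lt_div_of_pos_left (by norm_num) (by positivity) (by nlinarith)
  exact Real.sqrt_lt_sqrt (by positivity) (by linarith)

/-- With `s = √(1 + 8/b²)`, which decreases from 3 to 1, this exhibits `A` as `√(1 - u²)` for `u =
(s - 1)/2` in `(0, 1]`. Monotonicity and concavity of `A` are read off from `u` being decreasing and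
convex. -/
theorem momentA_eq {b : ℝ} :
    momentA b = √(1 - ((√(1 + 8 / b ^ 2) - 1) / 2) ^ 2) := by
  have h : √(1 + 8 / b ^ 2) ^ 2 = 1 + 8 / b ^ 2 := Real.sq_sqrt (by positivity)
  unfold momentA
  congr 1
  have : 2 / b ^ 2 = (8 / b ^ 2) / 4 := by ring
  rw [this]
  linarith

theorem momentA_one : momentA 1 = 0 := by
  have : √(9 : ℝ) = 3 := by
    rw [show (9 : ℝ) = 3 ^ 2 by norm_num]; exact Real.sqrt_sq (by norm_num)
  rw [momentA_eq]
  norm_num [this]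

theorem momentA_lt_one {b : ℝ} (hb : 1 ≤ b) : momentA b < 1 := by
  rw [momentA_eq, Real.sqrt_lt' one_pos]
  nlinarith [one_lt_sqrt_one_add hb]

theorem momentA_strictMonoOn : StrictMonoOn momentA (Set.Ici 1) := by
  intro b hb c hc hbc
  rw [momentA_eq, momentA_eq]
  have h1 := one_lt_sqrt_one_add (b := c) hc
  have h2 := sqrt_one_add_le (b := b) hb
  have h3 := sqrt_one_add_lt hb hbc
  exact Real.sqrt_lt_sqrt (by nlinarith) (by nlinarith)

theorem momentA_tendsto : Filter.Tendsto momentA Filter.atTop (nhds 1) := by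
  have h (c : ℝ) : Filter.Tendsto (fun b : ℝ => c / b ^ 2) Filter.atTop (nhds 0) :=
    tendsto_const_nhds.div_atTop (Filter.tendsto_pow_atTop two_ne_zero)
  have := ((((((h 8).const_add 1).sqrt).const_mul (1 / 2)).add_const (1 / 2)).sub (h 2)).sqrt
  norm_num at this
  refine this.congr fun b => ?_
  norm_num [momentA]

theorem sqrt_one_add_convex : ConvexOn ℝ (Set.Ici 1) (fun b : ℝ => √(1 + 8 / b ^ 2)) := by
  refine ⟨convex_Ici 1, fun x hx y hy p q hp hq hpq => ?_⟩
  have hx' : (0 : ℝ) < x := lt_of_lt_of_le one_pos hx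
  have hy' : (0 : ℝ) < y := lt_of_lt_of_le one_pos hy
  have hz : 0 < p * x + q * y := lt_of_lt_of_le one_pos (convex_Ici (1 : ℝ) hx hy hp hq hpq)
  have hinv : (p * x + q * y)⁻¹ ≤ p * x⁻¹ + q * y⁻¹ := by
    have := (convexOn_zpow (𝕜 := ℝ) (-1)).2 hx' hy' hp hq hpq
    simpa using this
  have h8 (b : ℝ) : √(1 + 8 / b ^ 2) = √(1 + (√8 * b⁻¹) ^ 2) := by
    rw [mul_pow, Real.sq_sqrt (by norm_num), inv_pow, div_eq_mul_inv]
  simp only [smul_eq_mul, h8]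
  have := (sqrt_add_sq_convex one_pos.le).2 (Set.mem_univ (√8 * x⁻¹)) (Set.mem_univ (√8 * y⁻¹))
    hp hq hpq
  simp only [smul_eq_mul] at this
  refine le_trans (Real.sqrt_le_sqrt ?_) this
  have h0 : 0 ≤ √8 * (p * x + q * y)⁻¹ := by positivity
  have h1 : √8 * (p * x + q * y)⁻¹ ≤ p * (√8 * x⁻¹) + q * (√8 * y⁻¹) := by
    calc _ ≤ √8 * (p * x⁻¹ + q * y⁻¹) := by gcongr
      _ = _ := by ring
  gcongr

theorem sqrt_one_sub_sq_concave {x y p q : ℝ} (hx : x ^ 2 ≤ 1) (hy : y ^ 2 ≤ 1) (hp : 0 ≤ p)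
    (hq : 0 ≤ q) (hpq : p + q = 1) :
    p * √(1 - x ^ 2) + q * √(1 - y ^ 2) ≤ √(1 - (p * x + q * y) ^ 2) := by
  have hx' : 0 ≤ 1 - x ^ 2 := by linarith
  have hy' : 0 ≤ 1 - y ^ 2 := by linarith
  refine Real.le_sqrt_of_sq_le ?_
  have h : √(1 - x ^ 2) * √(1 - y ^ 2) ≤ 1 - x * y := by
    nlinarith [sq_nonneg (√(1 - x ^ 2) - √(1 - y ^ 2)), sq_nonneg (x - y), Real.sq_sqrt hx',
      Real.sq_sqrt hy']
  obtain rfl : q = 1 - p := by linarith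
  have e : (1 - (p * x + (1 - p) * y) ^ 2) - (p * √(1 - x ^ 2) + (1 - p) * √(1 - y ^ 2)) ^ 2 =
      2 * (p * (1 - p) * (1 - x * y) - p * (1 - p) * (√(1 - x ^ 2) * √(1 - y ^ 2))) := by
    linear_combination -p ^ 2 * Real.sq_sqrt hx' - (1 - p) ^ 2 * Real.sq_sqrt hy'
  linarith [mul_le_mul_of_nonneg_left h (mul_nonneg hp hq)]

theorem momentA_concave : ConcaveOn ℝ (Set.Ici 1) momentA := by
  refine ⟨convex_Ici 1, fun x hx y hy p q hp hq hpq => ?_⟩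
  have hz := convex_Ici (1 : ℝ) hx hy hp hq hpq
  have hc := sqrt_one_add_convex.2 hx hy hp hq hpq
  have x1 := one_lt_sqrt_one_add hx
  have x2 := sqrt_one_add_le hx
  have y1 := one_lt_sqrt_one_add hy
  have y2 := sqrt_one_add_le hy
  have z1 := one_lt_sqrt_one_add hz
  simp only [momentA_eq, smul_eq_mul] at *
  refine (sqrt_one_sub_sq_concave (by nlinarith) (by nlinarith) hp hq hpq).trans
    (Real.sqrt_le_sqrt ?_)
  have : (√(1 + 8 / (p * x + q * y) ^ 2) - 1) / 2 ≤
      p * ((√(1 + 8 / x ^ 2) - 1) / 2) + q * ((√(1 + 8 / y ^ 2) - 1) / 2) := by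
    obtain rfl : q = 1 - p := by linarith
    linarith
  have h0 : 0 ≤ (√(1 + 8 / (p * x + q * y) ^ 2) - 1) / 2 := by linarith
  gcongr

/-- The equation `z - 2/z = b` has positive root `z = (1 + s) b / 2`, and `z² - 4 = (b A(b))²`.
Hence `b A(b)` is the third moment of the two-point law with third absolute moment `b`. -/
theorem twoPointAbsMoment_mul_momentA {b : ℝ} (hb : 1 ≤ b) :
    twoPointAbsMoment (b * momentA b) = b := by
  have hb0 : 0 < b := by linarith
  set s := √(1 + 8 / b ^ 2) with hs
  have hs1 : 1 < s := one_lt_sqrt_one_add hb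
  have hs3 : s ≤ 3 := sqrt_one_add_le hb
  have hs2 : s ^ 2 * b ^ 2 = b ^ 2 + 8 := by
    rw [hs, Real.sq_sqrt (by positivity)]; field_simp
  have hA : (b * momentA b) ^ 2 + 4 = ((1 + s) * b / 2) ^ 2 := by
    rw [momentA_eq, mul_pow, Real.sq_sqrt (by nlinarith)]
    linear_combination (-1 / 2) * hs2
  unfold twoPointAbsMoment
  rw [hA, Real.sqrt_sq (by positivity)]
  have : 0 < 1 + s := by linarith
  field_simp
  linear_combination hs2

theorem mul_momentA_concave : ConcaveOn ℝ (Set.Ici 1) (fun b => b * momentA b) := by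
  refine ⟨convex_Ici 1, fun x hx y hy p q hp hq hpq => ?_⟩
  have hz : (1 : ℝ) ≤ p * x + q * y := convex_Ici (1 : ℝ) hx hy hp hq hpq
  simp only [smul_eq_mul]
  refine le_of_twoPointAbsMoment_le (mul_nonneg (by linarith) (momentA_nonneg _)) ?_
  have := twoPointAbsMoment_convex.2 (Set.mem_univ (x * momentA x)) (Set.mem_univ (y * momentA y))
    hp hq hpq
  simp only [smul_eq_mul] at this
  rwa [twoPointAbsMoment_mul_momentA hx, twoPointAbsMoment_mul_momentA hy,
    ← twoPointAbsMoment_mul_momentA hz] at this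

/-! ### The bound for the third moment -/

/-- The difference of the two sides has a double zero at each of `a` and `-1/a`, the atoms of the
extremal law; the remaining factor is nonnegative on the corresponding half-line. -/
theorem cubic_duality {a : ℝ} (ha : 0 < a) (x : ℝ) :
    (a ^ 4 * (a ^ 2 + 3) - (3 * a ^ 2 + 1)) / 2 * x ^ 3 + 6 * a ^ 3 * x ^ 2
      - (3 * a ^ 4 - 3 * a ^ 2) * x - 2 * a ^ 3 ≤
    (a ^ 4 * (a ^ 2 + 3) + (3 * a ^ 2 + 1)) / 2 * |x| ^ 3 := by
  rcases le_total 0 x with hx | hx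
  · rw [abs_of_nonneg hx, ← sub_nonneg]
    have : 0 ≤ (x - a) ^ 2 * ((3 * a ^ 2 + 1) * x + 2 * a) := by positivity
    nlinarith
  · rw [abs_of_nonpos hx, ← sub_nonneg]
    have hx' : 0 ≤ -x := by linarith
    have : 0 ≤ (a * (-x) - 1) ^ 2 * (a ^ 2 * (a ^ 2 + 3) * (-x) + 2 * a ^ 3) := by positivity
    nlinarith

open MeasureTheory in
theorem integral_cube_le {μ : Measure ℝ} [IsProbabilityMeasure μ] {b : ℝ} (hb : 1 ≤ b)
    (h1 : Integrable (fun x => x) μ) (h2 : Integrable (fun x => x ^ 2) μ)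
    (h3 : Integrable (fun x => |x| ^ 3) μ) (m1 : ∫ x, x ∂μ = 0) (m2 : ∫ x, x ^ 2 ∂μ = 1)
    (m3 : ∫ x, |x| ^ 3 ∂μ = b) : ∫ x, x ^ 3 ∂μ ≤ b * momentA b := by
  set w := ∫ x, x ^ 3 ∂μ with hw
  have hbA : 0 ≤ b * momentA b := mul_nonneg (by linarith) (momentA_nonneg _)
  rcases le_or_gt w 0 with hw0 | hw0
  · exact hw0.trans hbA
  refine le_of_twoPointAbsMoment_le hbA ?_
  rw [twoPointAbsMoment_mul_momentA hb]
  have h3' : Integrable (fun x : ℝ => x ^ 3) μ :=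
    h3.mono' (by fun_prop) (by simp)
  set z := √(w ^ 2 + 4) with hz
  have hz0 : 0 < z := Real.sqrt_pos.2 (by positivity)
  have hz2 : z ^ 2 = w ^ 2 + 4 := Real.sq_sqrt (by positivity)
  -- The positive atom of the two-point law whose third moment is `w`, that is, the positive root of
  -- `a - 1/a = w`.
  obtain ⟨a, ha⟩ : ∃ a, a = (w + z) / 2 := ⟨_, rfl⟩
  have ha0 : 0 < a := by rw [ha]; positivity
  have haw : a ^ 2 = w * a + 1 := by rw [ha]; linear_combination hz2 / 4
  have haz : a * z = a ^ 2 + 1 := by rw [ha]; linear_combination hz2 / 4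
  have i1 := h3.const_mul ((a ^ 4 * (a ^ 2 + 3) + (3 * a ^ 2 + 1)) / 2)
  have i2 := h3'.const_mul ((a ^ 4 * (a ^ 2 + 3) - (3 * a ^ 2 + 1)) / 2)
  have i3 := h2.const_mul (6 * a ^ 3)
  have i4 := h1.const_mul (3 * a ^ 4 - 3 * a ^ 2)
  have i5 : Integrable (fun x : ℝ => (a ^ 4 * (a ^ 2 + 3) - (3 * a ^ 2 + 1)) / 2 * x ^ 3 +
      6 * a ^ 3 * x ^ 2) μ := i2.add i3
  have i6 : Integrable (fun x : ℝ => (a ^ 4 * (a ^ 2 + 3) - (3 * a ^ 2 + 1)) / 2 * x ^ 3 +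
      6 * a ^ 3 * x ^ 2 - (3 * a ^ 4 - 3 * a ^ 2) * x) μ := i5.sub i4
  have key : ∫ x, ((a ^ 4 * (a ^ 2 + 3) - (3 * a ^ 2 + 1)) / 2 * x ^ 3 + 6 * a ^ 3 * x ^ 2
      - (3 * a ^ 4 - 3 * a ^ 2) * x - 2 * a ^ 3) ∂μ ≤
      ∫ x, (a ^ 4 * (a ^ 2 + 3) + (3 * a ^ 2 + 1)) / 2 * |x| ^ 3 ∂μ :=
    integral_mono (i6.sub (integrable_const (2 * a ^ 3))) i1 (fun x => cubic_duality ha0 x)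
  have e4 : ∫ x, (3 * a ^ 4 - 3 * a ^ 2) * x ∂μ = 0 := by rw [integral_const_mul, m1, mul_zero]
  rw [integral_sub i6 (integrable_const _), integral_sub i5 i4, integral_add i2 i3, e4] at key
  simp only [integral_const_mul, m2, m3, ← hw, integral_const, probReal_univ, smul_eq_mul]
    at key
  unfold twoPointAbsMoment
  rw [← hz]
  obtain ⟨D, hD⟩ : ∃ D, D = (a ^ 4 * (a ^ 2 + 3) + (3 * a ^ 2 + 1)) / 2 := ⟨_, rfl⟩
  have hD0 : 0 < D := by rw [hD]; positivity
  refine le_of_mul_le_mul_left ?_ hD0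
  have e1 : z = (a ^ 2 + 1) / a := by field_simp; linarith
  have e2 : w = (a ^ 2 - 1) / a := by field_simp; linarith
  calc D * (z - 2 / z) =
      (a ^ 4 * (a ^ 2 + 3) - (3 * a ^ 2 + 1)) / 2 * w + 4 * a ^ 3 := by
        rw [e1, e2, hD]; field_simp; ring
    _ ≤ D * b := by rw [hD]; linarith

/-! ### Taylor remainders of the exponential and the function `qFun` -/

/-- `e^{ix} - ∑_{k < n} (ix)^k / k! - lam (ix)^n / n!`. -/
noncomputable def expRem (n : ℕ) (lam x : ℝ) : ℂ :=
  Complex.exp (Complex.I * x) - ∑ k ∈ Finset.range n, (Complex.I * x) ^ k / (k.factorial : ℂ)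
    - (lam : ℂ) * ((Complex.I * x) ^ n / (n.factorial : ℂ))

theorem hasDerivAt_I_mul_pow_div (k : ℕ) (x : ℝ) :
    HasDerivAt (fun x : ℝ => (Complex.I * x) ^ (k + 1) / ((k + 1).factorial : ℂ))
      (Complex.I * ((Complex.I * x) ^ k / (k.factorial : ℂ))) x := by
  have h : HasDerivAt (fun x : ℝ => Complex.I * (x : ℂ)) Complex.I x := by
    simpa using (Complex.ofRealCLM.hasDerivAt (x := x)).const_mul Complex.I
  convert! (h.pow (k + 1)).div_const ((k + 1).factorial : ℂ) using 1
  have h1 : (k.factorial : ℂ) ≠ 0 := by exact_mod_cast k.factorial_ne_zero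
  have h2 : (k + 1 : ℂ) ≠ 0 := by exact_mod_cast k.succ_ne_zero
  rw [Nat.factorial_succ]
  push_cast
  field_simp

theorem hasDerivAt_expRem_succ (n : ℕ) (lam x : ℝ) :
    HasDerivAt (expRem (n + 1) lam) (Complex.I * expRem n lam x) x := by
  have h : HasDerivAt (fun x : ℝ => Complex.I * (x : ℂ)) Complex.I x := by
    simpa using (Complex.ofRealCLM.hasDerivAt (x := x)).const_mul Complex.I
  have hs : HasDerivAt (fun x : ℝ => ∑ k ∈ Finset.range (n + 1),
      (Complex.I * x) ^ k / (k.factorial : ℂ))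
      (∑ k ∈ Finset.range n, Complex.I * ((Complex.I * x) ^ k / (k.factorial : ℂ))) x := by
    simp only [Finset.sum_range_succ']
    simpa using (HasDerivAt.fun_sum fun k (_ : k ∈ Finset.range n) =>
      hasDerivAt_I_mul_pow_div k x).add_const (1 : ℂ)
  convert! (h.cexp.sub hs).sub ((hasDerivAt_I_mul_pow_div n x).const_mul (lam : ℂ)) using 1
  rw [expRem, ← Finset.mul_sum]
  ring

theorem expRem_succ_zero (n : ℕ) (lam : ℝ) : expRem (n + 1) lam 0 = 0 := by
  simp [expRem, Finset.sum_range_succ']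

/-- Differentiating lowers the order by one and leaves `lam` unchanged, up to the factor `I`.
Integrating the bound from 0 therefore carries the same constant `c` to every higher order. -/
theorem norm_expRem_le_of_le {m : ℕ} {lam c : ℝ}
    (h : ∀ x : ℝ, 0 ≤ x → ‖expRem m lam x‖ ≤ c * (x ^ m / m.factorial)) {n : ℕ} (hn : m ≤ n) :
    ∀ x : ℝ, 0 ≤ x → ‖expRem n lam x‖ ≤ c * (x ^ n / n.factorial) := by
  induction n, hn using Nat.le_induction with
  | base => exact h
  | succ n _ ih =>
    intro x hx
    have hB : ∀ y : ℝ, HasDerivAt (fun y : ℝ => c * (y ^ (n + 1) / (n + 1).factorial))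
        (c * (y ^ n / n.factorial)) y := by
      intro y
      convert! (((hasDerivAt_id y).pow (n + 1)).div_const ((n + 1).factorial : ℝ)).const_mul c
        using 1
      have h1 : (n.factorial : ℝ) ≠ 0 := by exact_mod_cast n.factorial_ne_zero
      rw [Nat.factorial_succ]
      push_cast
      simp only [id]
      field_simp
    refine image_norm_le_of_norm_deriv_right_le_deriv_boundary (a := 0) (b := x)
      (fun y _ => (hasDerivAt_expRem_succ n lam y).continuousAt.continuousWithinAt)
      (fun y _ => (hasDerivAt_expRem_succ n lam y).hasDerivWithinAt) (by simp [expRem_succ_zero])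
      hB (fun y hy => ?_) (Set.right_mem_Icc.2 hx)
    simpa using ih y hy.1

theorem norm_expRem_zero_le (n : ℕ) {x : ℝ} (hx : 0 ≤ x) :
    ‖expRem n 0 x‖ ≤ x ^ n / n.factorial := by
  simpa using norm_expRem_le_of_le (m := 0) (lam := 0) (c := 1)
    (fun y _ => by simp [expRem]) n.zero_le x hx

theorem expRem_eq (n : ℕ) (a b x : ℝ) :
    expRem n a x = expRem n b x - ((a - b : ℝ) : ℂ) * ((Complex.I * x) ^ n / (n.factorial : ℂ)) := by
  simp only [expRem]
  push_cast
  ring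

theorem norm_I_mul_pow_div (n : ℕ) {x : ℝ} (hx : 0 ≤ x) :
    ‖(Complex.I * (x : ℂ)) ^ n / (n.factorial : ℂ)‖ = x ^ n / n.factorial := by
  simp [abs_of_nonneg hx]

theorem norm_expRem_le_add (n : ℕ) (a b : ℝ) {x : ℝ} (hx : 0 ≤ x) :
    ‖expRem n a x‖ ≤ ‖expRem n b x‖ + |a - b| * (x ^ n / n.factorial) := by
  rw [expRem_eq n a b]
  refine (norm_sub_le _ _).trans_eq ?_
  rw [norm_mul, norm_I_mul_pow_div n hx, Complex.norm_real, Real.norm_eq_abs]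

theorem qFun_le {n : ℕ} {lam c : ℝ}
    (h : ∀ x : ℝ, 0 < x → ‖expRem n lam x‖ ≤ c * (x ^ n / n.factorial)) : qFun n lam ≤ c := by
  refine csSup_le (Set.nonempty_Ioi.image _) ?_
  rintro _ ⟨x, hx, rfl⟩
  have hx : 0 < x := hx
  have hn : (0 : ℝ) < n.factorial := by exact_mod_cast n.factorial_pos
  have := mul_le_mul_of_nonneg_left (h x hx) (by positivity : 0 ≤ (n.factorial : ℝ) / x ^ n)
  refine this.trans_eq ?_
  field_simp

theorem norm_expRem_le_qFun (n : ℕ) (lam : ℝ) {x : ℝ} (hx : 0 < x) :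
    ‖expRem n lam x‖ ≤ qFun n lam * (x ^ n / n.factorial) := by
  have hn : (0 : ℝ) < n.factorial := by exact_mod_cast n.factorial_pos
  have hq : (n.factorial : ℝ) / x ^ n * ‖expRem n lam x‖ ≤ qFun n lam := by
    refine le_csSup ⟨1 + |lam|, ?_⟩ ⟨x, hx, rfl⟩
    rintro _ ⟨y, hy, rfl⟩
    have hy : 0 < y := hy
    have h1 : ‖expRem n lam y‖ ≤ (1 + |lam|) * (y ^ n / n.factorial) := by
      have h2 := norm_expRem_le_add n lam 0 hy.le
      have h3 := norm_expRem_zero_le n hy.le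
      rw [sub_zero] at h2
      linarith
    have := mul_le_mul_of_nonneg_left h1 (by positivity : 0 ≤ (n.factorial : ℝ) / y ^ n)
    refine this.trans_eq ?_
    field_simp
  have := mul_le_mul_of_nonneg_right hq (by positivity : 0 ≤ x ^ n / (n.factorial : ℝ))
  refine le_of_eq_of_le ?_ this
  field_simp

theorem norm_expRem_neg (n : ℕ) (lam x : ℝ) : ‖expRem n lam (-x)‖ = ‖expRem n lam x‖ := by
  rw [← Complex.norm_conj (expRem n lam x)]
  congr 1
  simp only [expRem, map_sub, map_sum, map_mul, map_div₀, map_pow, Complex.conj_I,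
    Complex.conj_ofReal, map_natCast, ← Complex.exp_conj]
  push_cast
  simp

theorem norm_expRem_le_qFun_abs {n : ℕ} (hn : 1 ≤ n) (lam x : ℝ) :
    ‖expRem n lam x‖ ≤ qFun n lam * (|x| ^ n / n.factorial) := by
  rcases lt_trichotomy x 0 with h | rfl | h
  · rw [← norm_expRem_neg, abs_of_neg h]
    exact norm_expRem_le_qFun n lam (neg_pos.2 h)
  · obtain ⟨m, rfl⟩ := Nat.exists_eq_add_of_le' hn
    simp [expRem_succ_zero]
  · rw [abs_of_pos h]
    exact norm_expRem_le_qFun n lam h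

theorem qFun_le_add (n : ℕ) (a b : ℝ) : qFun n a ≤ qFun n b + |a - b| :=
  qFun_le fun x hx => by
    have h1 := norm_expRem_le_add n a b hx.le
    have h2 := norm_expRem_le_qFun n b hx
    linarith

theorem continuous_qFun (n : ℕ) : Continuous (qFun n) := by
  refine (LipschitzWith.of_le_add fun a b => ?_ : LipschitzWith 1 (qFun n)).continuous
  rw [Real.dist_eq]
  exact qFun_le_add n a b

/-- As `x → 0` the quotient defining `qFun` tends to `|1 - lam|`. -/
theorem one_sub_le_qFun (n : ℕ) (lam : ℝ) : 1 - lam ≤ qFun n lam := by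
  refine le_of_forall_pos_le_add fun x hx => ?_
  have hn : (0 : ℝ) < n.factorial := by exact_mod_cast n.factorial_pos
  have h1 := norm_expRem_zero_le (n + 1) hx.le
  have h2 := norm_expRem_le_qFun n lam hx
  have e : ((1 - lam : ℝ) : ℂ) * ((Complex.I * x) ^ n / (n.factorial : ℂ)) =
      expRem n lam x - expRem (n + 1) 0 x := by
    simp only [expRem, Finset.sum_range_succ]
    push_cast
    ring
  have h3 : (1 - lam) * (x ^ n / n.factorial) ≤ (qFun n lam + x) * (x ^ n / n.factorial) := by
    calc (1 - lam) * (x ^ n / n.factorial) ≤ |1 - lam| * (x ^ n / n.factorial) := by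
          gcongr; exact le_abs_self _
      _ = ‖expRem n lam x - expRem (n + 1) 0 x‖ := by
          rw [← e, norm_mul, norm_I_mul_pow_div n hx.le, Complex.norm_real, Real.norm_eq_abs]
      _ ≤ qFun n lam * (x ^ n / n.factorial) + x ^ (n + 1) / (n + 1).factorial :=
          (norm_sub_le _ _).trans (add_le_add h2 h1)
      _ ≤ qFun n lam * (x ^ n / n.factorial) + x * (x ^ n / n.factorial) := by
          gcongr
          rw [pow_succ', mul_div_assoc]
          gcongr
          exact n.le_succ
      _ = _ := by ring
  exact le_of_mul_le_mul_right h3 (by positivity)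

/-- As `x → ∞` the term of order `n` dominates and the quotient tends to `|lam|`. -/
theorem le_qFun {n : ℕ} (hn : 1 ≤ n) (lam : ℝ) : lam ≤ qFun n lam := by
  obtain ⟨m, rfl⟩ := Nat.exists_eq_add_of_le' hn
  refine le_of_forall_pos_le_add fun ε hε => ?_
  have hm : (0 : ℝ) < m.factorial := by exact_mod_cast m.factorial_pos
  -- Chosen so that the two lower-order contributions, `x^m / m!` each, add up to exactly `ε x^(m+1)
  -- / (m+1)!`.
  set x : ℝ := 2 * (m + 1) / ε with hx'
  have hx : 0 < x := by positivity
  have h1 := norm_expRem_zero_le m hx.le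
  have h2 := norm_expRem_le_qFun (m + 1) lam hx
  have e : (lam : ℂ) * ((Complex.I * x) ^ (m + 1) / ((m + 1).factorial : ℂ)) =
      expRem m 0 x - (Complex.I * x) ^ m / (m.factorial : ℂ) - expRem (m + 1) lam x := by
    simp only [expRem, Finset.sum_range_succ]
    push_cast
    ring
  have e2 : x ^ m / m.factorial + x ^ m / m.factorial =
      ε * (x ^ (m + 1) / (m + 1).factorial) := by
    have : ε * x = 2 * (m + 1) := by rw [hx']; field_simp
    rw [Nat.factorial_succ, pow_succ]
    push_cast
    field_simp
    linear_combination -this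
  have h3 : lam * (x ^ (m + 1) / (m + 1).factorial) ≤
      (qFun (m + 1) lam + ε) * (x ^ (m + 1) / (m + 1).factorial) := by
    calc lam * (x ^ (m + 1) / (m + 1).factorial) ≤ |lam| * (x ^ (m + 1) / (m + 1).factorial) := by
          gcongr; exact le_abs_self _
      _ = ‖expRem m 0 x - (Complex.I * x) ^ m / (m.factorial : ℂ) - expRem (m + 1) lam x‖ := by
          rw [← e, norm_mul, norm_I_mul_pow_div _ hx.le, Complex.norm_real, Real.norm_eq_abs]
      _ ≤ x ^ m / m.factorial + x ^ m / m.factorial +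
          qFun (m + 1) lam * (x ^ (m + 1) / (m + 1).factorial) := by
          refine (norm_sub_le _ _).trans (add_le_add ((norm_sub_le _ _).trans ?_) h2)
          rw [norm_I_mul_pow_div m hx.le]
          gcongr
      _ = _ := by rw [e2]; ring
  exact le_of_mul_le_mul_right h3 (by positivity)

/-! ### Trigonometric inequalities -/

theorem nonneg_of_hasDerivAt {f f' : ℝ → ℝ} {b : ℝ} (h : ∀ x, HasDerivAt f (f' x) x)
    (h0 : f 0 = 0) (hf' : ∀ x, 0 ≤ x → x ≤ b → 0 ≤ f' x) {x : ℝ} (hx : 0 ≤ x) (hxb : x ≤ b) :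
    0 ≤ f x := by
  have hm : MonotoneOn f (Set.Icc 0 b) := by
    refine monotoneOn_of_deriv_nonneg (convex_Icc 0 b)
      (fun y _ => (h y).continuousAt.continuousWithinAt)
      (fun y _ => (h y).differentiableAt.differentiableWithinAt) fun y hy => ?_
    rw [interior_Icc] at hy
    rw [(h y).deriv]
    exact hf' y hy.1.le hy.2.le
  rw [← h0]
  exact hm ⟨le_rfl, hx.trans hxb⟩ ⟨hx, hxb⟩ hx

theorem mul_cos_le_sin {x : ℝ} (hx : 0 ≤ x) (hxp : x ≤ Real.pi) : x * Real.cos x ≤ Real.sin x := by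
  have := nonneg_of_hasDerivAt (f := fun x => Real.sin x - x * Real.cos x)
    (f' := fun x => x * Real.sin x) (b := Real.pi) (fun y => by
      convert! (Real.hasDerivAt_sin y).sub ((hasDerivAt_id y).mul (Real.hasDerivAt_cos y)) using 1
      simp only [id]
      ring) (by simp)
    (fun y hy hyp => mul_nonneg hy (Real.sin_nonneg_of_nonneg_of_le_pi hy hyp)) hx hxp
  simpa using this

/-- Up to `2π`, two differentiations reduce this to `2 - 2 cos y - y sin y ≥ 0`, which in
half-angles is `4 sin(y/2) (sin(y/2) - (y/2) cos(y/2)) ≥ 0`. Beyond `2π` the quadratic term wins. It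
serves twice: for `q_n(s) ≤ 1 - s` and, at `2x`, for `cot_quotient_monotoneOn`. -/
theorem four_mul_one_sub_cos_le {x : ℝ} (hx : 0 ≤ x) :
    4 * (1 - Real.cos x) ≤ x ^ 2 + x * Real.sin x := by
  rcases le_total x (2 * Real.pi) with hxp | hxp
  · have h3 : ∀ y : ℝ, 0 ≤ y → y ≤ 2 * Real.pi →
        0 ≤ 2 - 2 * Real.cos y - y * Real.sin y := by
      intro y hy hyp
      have e1 : Real.cos y = 2 * Real.cos (y / 2) ^ 2 - 1 := by
        rw [← Real.cos_two_mul]; ring_nf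
      have e2 : Real.sin y = 2 * Real.sin (y / 2) * Real.cos (y / 2) := by
        rw [← Real.sin_two_mul]; ring_nf
      have h1 := Real.sin_nonneg_of_nonneg_of_le_pi (x := y / 2) (by linarith) (by linarith)
      have h2 := mul_cos_le_sin (x := y / 2) (by linarith) (by linarith)
      have h4 := Real.sin_sq_add_cos_sq (y / 2)
      rw [e1, e2]
      nlinarith [mul_nonneg h1 (sub_nonneg.2 h2)]
    have h2 : ∀ y : ℝ, 0 ≤ y → y ≤ 2 * Real.pi →
        0 ≤ 2 * y - 3 * Real.sin y + y * Real.cos y := by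
      intro y hy hyp
      refine nonneg_of_hasDerivAt (f := fun y => 2 * y - 3 * Real.sin y + y * Real.cos y)
        (fun y => ?_) (by simp) h3 hy hyp
      convert! (((hasDerivAt_id y).const_mul 2).sub ((Real.hasDerivAt_sin y).const_mul 3)).add
        ((hasDerivAt_id y).mul (Real.hasDerivAt_cos y)) using 1
      simp only [id]
      ring
    have h1 : 0 ≤ x ^ 2 + x * Real.sin x - 4 * (1 - Real.cos x) := by
      refine nonneg_of_hasDerivAt (f := fun y => y ^ 2 + y * Real.sin y - 4 * (1 - Real.cos y))
        (fun y => ?_) (by simp) h2 hx hxp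
      convert! (((hasDerivAt_id y).pow 2).add ((hasDerivAt_id y).mul (Real.hasDerivAt_sin y))).sub
        (((Real.hasDerivAt_cos y).const_sub 1).const_mul 4) using 1
      simp only [id]
      norm_num
      ring
    linarith
  · have := Real.pi_gt_three
    nlinarith [Real.neg_one_le_sin x, Real.neg_one_le_cos x]

theorem sq_norm_expRem_one (lam x : ℝ) :
    ‖expRem 1 lam x‖ ^ 2 =
      2 * (1 - Real.cos x) - 2 * lam * x * Real.sin x + lam ^ 2 * x ^ 2 := by
  have h : expRem 1 lam x = ((Real.cos x - 1 : ℝ) : ℂ) + ((Real.sin x - lam * x : ℝ) : ℂ) *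
      Complex.I := by
    simp only [expRem, Finset.sum_range_one, pow_zero, pow_one, Nat.factorial_one,
      Nat.factorial_zero]
    rw [mul_comm Complex.I, Complex.exp_mul_I]
    push_cast
    ring
  rw [h, Complex.sq_norm, Complex.normSq_add_mul_I]
  linear_combination Real.sin_sq_add_cos_sq x

theorem norm_expRem_one_le {lam c k x : ℝ} (hc : 0 ≤ c) (hx : 0 ≤ x) (hk : k + lam ^ 2 = c ^ 2)
    (h : 2 * (1 - Real.cos x) - 2 * lam * x * Real.sin x ≤ k * x ^ 2) :
    ‖expRem 1 lam x‖ ≤ c * x := by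
  refine le_of_sq_le_sq ?_ (mul_nonneg hc hx)
  rw [sq_norm_expRem_one, mul_pow, ← hk]
  linarith

/-- By `norm_expRem_le_of_le` it suffices to treat order 1. After squaring, the condition is linear
in `s` and hardest at `s = 1/4`, where it is `four_mul_one_sub_cos_le`. -/
theorem qFun_le_one_sub {n : ℕ} (hn : 1 ≤ n) {s : ℝ} (hs4 : s ≤ 1 / 4) :
    qFun n s ≤ 1 - s := by
  refine qFun_le fun x hx => norm_expRem_le_of_le (m := 1) (fun y hy => ?_) hn x hx.le
  simp only [pow_one, Nat.factorial_one, Nat.cast_one, div_one]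
  refine norm_expRem_one_le (k := 1 - 2 * s) (by linarith) hy (by ring) ?_
  have h1 := four_mul_one_sub_cos_le hy
  have h2 : 0 ≤ y * (y - Real.sin y) := mul_nonneg hy (sub_nonneg.2 (Real.sin_le hy))
  nlinarith [mul_le_mul_of_nonneg_right hs4 h2]

/-! ### The root `θ` -/

theorem hasDerivAt_thetaFun (x : ℝ) :
    HasDerivAt (fun x => x * Real.sin x + Real.cos x - 1) (x * Real.cos x) x := by
  convert! (((hasDerivAt_id x).mul (Real.hasDerivAt_sin x)).add
    (Real.hasDerivAt_cos x)).sub_const 1 using 1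
  simp only [id]
  ring

theorem thetaFun_strictAntiOn :
    StrictAntiOn (fun x => x * Real.sin x + Real.cos x - 1) (Set.Icc (Real.pi / 2) Real.pi) := by
  refine strictAntiOn_of_deriv_neg (convex_Icc _ _)
    (fun y _ => (hasDerivAt_thetaFun y).continuousAt.continuousWithinAt) fun y hy => ?_
  rw [interior_Icc] at hy
  rw [(hasDerivAt_thetaFun y).deriv]
  have := Real.pi_pos
  exact mul_neg_of_pos_of_neg (by linarith [hy.1])
    (Real.cos_neg_of_pi_div_two_lt_of_lt hy.1 (by linarith [hy.2]))

theorem thetaFun_two_pi_div_three_pos :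
    0 < 2 * Real.pi / 3 * Real.sin (2 * Real.pi / 3) + Real.cos (2 * Real.pi / 3) - 1 := by
  have e : 2 * Real.pi / 3 = Real.pi - Real.pi / 3 := by ring
  have hs : Real.sin (2 * Real.pi / 3) = √3 / 2 := by
    rw [e, Real.sin_pi_sub, Real.sin_pi_div_three]
  have hc : Real.cos (2 * Real.pi / 3) = -(1 / 2) := by
    rw [e, Real.cos_pi_sub, Real.cos_pi_div_three]
  rw [hs, hc]
  have h3 : 1.7 < √3 := Real.lt_sqrt_of_sq_lt (by norm_num)
  nlinarith [Real.pi_gt_three]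

theorem thetaFun_pos {x : ℝ} (hx : 0 < x) (hx3 : x ≤ 2 * Real.pi / 3) :
    0 < x * Real.sin x + Real.cos x - 1 := by
  have hpi := Real.pi_pos
  rcases le_total x (Real.pi / 2) with h | h
  · have hm : StrictMonoOn (fun x => x * Real.sin x + Real.cos x - 1)
        (Set.Icc 0 (Real.pi / 2)) := by
      refine strictMonoOn_of_deriv_pos (convex_Icc _ _)
        (fun y _ => (hasDerivAt_thetaFun y).continuousAt.continuousWithinAt) fun y hy => ?_
      rw [interior_Icc] at hy
      rw [(hasDerivAt_thetaFun y).deriv]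
      exact mul_pos hy.1 (Real.cos_pos_of_mem_Ioo ⟨by linarith [hy.1], hy.2⟩)
    simpa using hm ⟨le_rfl, by linarith⟩ ⟨hx.le, h⟩ hx
  · exact thetaFun_two_pi_div_three_pos.trans_le
      (thetaFun_strictAntiOn.antitoneOn ⟨h, by linarith⟩ ⟨by linarith, by linarith⟩ hx3)

theorem IsThetaOne.two_pi_div_three_lt {θ : ℝ} (h : IsThetaOne θ) : 2 * Real.pi / 3 < θ := by
  by_contra! h'
  exact (thetaFun_pos h.1.1 h').ne' h.2

theorem existsUnique_isThetaOne : ∃! θ : ℝ, IsThetaOne θ := by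
  have hpi := Real.pi_pos
  obtain ⟨θ, hθ, h0⟩ := intermediate_value_Ioo' (a := 2 * Real.pi / 3) (b := Real.pi)
    (f := fun x => x * Real.sin x + Real.cos x - 1) (by linarith) (by fun_prop)
    (show (0 : ℝ) ∈ _ from ⟨by norm_num, thetaFun_two_pi_div_three_pos⟩)
  have hθ' : IsThetaOne θ := ⟨⟨by linarith [hθ.1], hθ.2⟩, h0⟩
  refine ⟨θ, hθ', fun η hη => ?_⟩
  have := hη.two_pi_div_three_lt
  exact thetaFun_strictAntiOn.injOn ⟨by linarith, hη.1.2.le⟩ ⟨by linarith [hθ.1], hθ.2.le⟩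
    (hη.2.trans h0.symm)

theorem IsThetaOne.sin_pos {θ : ℝ} (h : IsThetaOne θ) : 0 < Real.sin θ :=
  Real.sin_pos_of_pos_of_lt_pi h.1.1 h.1.2

/-- The root equation says `tan(θ/2) = θ`. So `1 + cos θ = sin θ / θ`, the value of `lam` used for
`n = 1`. -/
theorem IsThetaOne.sin_eq {θ : ℝ} (h : IsThetaOne θ) :
    Real.sin θ = θ * (1 + Real.cos θ) := by
  refine mul_left_cancel₀ h.sin_pos.ne' ?_
  linear_combination Real.sin_sq_add_cos_sq θ - (1 + Real.cos θ) * h.2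

theorem IsThetaOne.one_add_cos_mul {θ : ℝ} (h : IsThetaOne θ) :
    (1 + Real.cos θ) * (1 + θ ^ 2) = 2 := by
  linear_combination -θ * h.sin_eq + h.2

theorem IsThetaOne.inv_mul_eq_sin {θ : ℝ} (h : IsThetaOne θ) :
    θ⁻¹ * (1 - Real.cos θ) = Real.sin θ := by
  have := h.1.1.ne'
  field_simp
  linear_combination -h.2

theorem sin_le_of_isThetaOne {θ : ℝ} (h : IsThetaOne θ) : θ⁻¹ * (1 - Real.cos θ) ≤ 0.7247 := by
  have h1 := h.two_pi_div_three_lt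
  have h2 := h.1.2
  have hpi := Real.pi_gt_d6
  have hpi' := Real.pi_lt_d6
  -- The root lies close to `3π/4`, so `d` is small and Taylor bounds at `3π/4` suffice; only `2π/3
  -- < θ < π` is used.
  obtain ⟨d, hd⟩ : ∃ d, d = 3 * Real.pi / 4 - θ := ⟨_, rfl⟩
  have hd1 : -0.79 < d := by rw [hd]; linarith
  have hd2 : d < 0.27 := by rw [hd]; linarith
  have e : Real.cos θ = -(√2 / 2 * (Real.cos d - Real.sin d)) := by
    rw [show θ = Real.pi - (Real.pi / 4 + d) by rw [hd]; ring, Real.cos_pi_sub, Real.cos_add,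
      Real.cos_pi_div_four, Real.sin_pi_div_four]
    ring
  have habs : |d| ≤ 1 := abs_le.2 ⟨by linarith, by linarith⟩
  have hc := (abs_le.1 (Real.cos_bound habs)).2
  have hs := (abs_le.1 (Real.sin_bound habs)).1
  have hd4 : |d| ^ 4 = d ^ 4 := by rw [← abs_pow, abs_of_nonneg (by positivity)]
  have hd5 : |d| ^ 5 ≤ d ^ 4 := by
    rw [pow_succ, hd4]; exact mul_le_of_le_one_right (by positivity) habs
  rw [hd4] at hc
  have s1 : 1.41421 < √2 := Real.lt_sqrt_of_sq_lt (by norm_num)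
  have s2 : √2 < 1.41422 := by rw [Real.sqrt_lt' (by norm_num)]; norm_num
  rw [inv_mul_le_iff₀ h.1.1, e]
  have key : Real.cos d - Real.sin d ≤ 1 - d - d ^ 2 / 2 + d ^ 3 / 6 + d ^ 4 * (10 / 96) := by
    linarith [show 0 ≤ d ^ 4 by positivity]
  -- The slack `0.06 = 1/2 - 0.44` absorbs the cubic and quartic terms on the range of `d`.
  have hq : 0 ≤ d ^ 2 * (0.06 - d / 6 - d ^ 2 * (10 / 96)) :=
    mul_nonneg (sq_nonneg d) (by nlinarith)
  have key2 : Real.cos d - Real.sin d ≤ 1 - d - 0.44 * d ^ 2 := by linarith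
  have key3 : √2 / 2 * (Real.cos d - Real.sin d) ≤ √2 / 2 * (1 - d - 0.44 * d ^ 2) := by gcongr
  have key4 : √2 / 2 * (1 - d - 0.44 * d ^ 2) ≤ 0.70711 * (1 - d - 0.44 * d ^ 2) := by
    gcongr
    · nlinarith
    · linarith
  have e3 : θ = 3 * Real.pi / 4 - d := by rw [hd]; ring
  rw [e3]
  -- What remains is a quadratic in `d` with its vertex near `0.0283` and a positive minimum.
  nlinarith [sq_nonneg (d - 0.0283)]

/-! ### The optimal bound for `n = 1` -/

theorem hasDerivAt_cot_quotient {x : ℝ} (hx : x ≠ 0) (hs : Real.sin x ≠ 0) :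
    HasDerivAt (fun x => (Real.sin x - x * Real.cos x) / (x ^ 2 * Real.sin x))
      ((x ^ 2 + x * Real.sin x * Real.cos x - 2 * Real.sin x ^ 2) / (x ^ 3 * Real.sin x ^ 2)) x := by
  convert! ((Real.hasDerivAt_sin x).sub ((hasDerivAt_id x).mul (Real.hasDerivAt_cos x))).div
    (((hasDerivAt_id x).pow 2).mul (Real.hasDerivAt_sin x))
    (mul_ne_zero (pow_ne_zero 2 hx) hs) using 1
  simp only [id, Pi.pow_apply, Pi.mul_apply, Pi.sub_apply]
  field_simp
  norm_num
  linear_combination -x ^ 3 * Real.sin_sq_add_cos_sq x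

/-- The quotient is `(1 - x cot x) / x²`; four times the numerator of its derivative is
`four_mul_one_sub_cos_le` at `2x`. -/
theorem cot_quotient_monotoneOn :
    MonotoneOn (fun x => (Real.sin x - x * Real.cos x) / (x ^ 2 * Real.sin x))
      (Set.Ioo 0 Real.pi) := by
  have hs : ∀ x ∈ Set.Ioo 0 Real.pi, 0 < Real.sin x :=
    fun x hx => Real.sin_pos_of_pos_of_lt_pi hx.1 hx.2
  refine monotoneOn_of_deriv_nonneg (convex_Ioo _ _)
    (fun x hx => (hasDerivAt_cot_quotient hx.1.ne' (hs x hx).ne').continuousAt.continuousWithinAt)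
    (fun x hx => ?_) (fun x hx => ?_)
  · rw [interior_Ioo] at hx
    exact (hasDerivAt_cot_quotient hx.1.ne'
      (hs x hx).ne').differentiableAt.differentiableWithinAt
  · rw [interior_Ioo] at hx
    rw [(hasDerivAt_cot_quotient hx.1.ne' (hs x hx).ne').deriv]
    have h := four_mul_one_sub_cos_le (x := 2 * x) (by linarith [hx.1])
    rw [Real.sin_two_mul, Real.cos_two_mul] at h
    have h0 := Real.sin_sq_add_cos_sq x
    have := hs x hx
    have := hx.1
    exact div_nonneg (by nlinarith) (by positivity)

theorem hasDerivAt_slopeFun (lam x : ℝ) :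
    HasDerivAt (fun x => (1 + lam) * (x * Real.sin x) - lam * (x ^ 2 * Real.cos x)
      - 2 * (1 - Real.cos x))
      (lam * (x ^ 2 * Real.sin x) - (1 - lam) * (Real.sin x - x * Real.cos x)) x := by
  convert! ((((hasDerivAt_id x).mul (Real.hasDerivAt_sin x)).const_mul (1 + lam)).sub
    ((((hasDerivAt_id x).pow 2).mul (Real.hasDerivAt_cos x)).const_mul lam)).sub
    (((Real.hasDerivAt_cos x).const_sub 1).const_mul 2) using 1
  simp only [id, Pi.pow_apply]
  norm_num
  ring

/-- On `(0, π)` the derivative computed in `hasDerivAt_slopeFun` changes sign from `+` to `-` at most once. -/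
theorem slope_deriv_sign {lam x y : ℝ} (hlam : lam < 1) (hx : 0 < x) (hxy : x ≤ y)
    (hy : y < Real.pi)
    (h : lam * (x ^ 2 * Real.sin x) - (1 - lam) * (Real.sin x - x * Real.cos x) ≤ 0) :
    lam * (y ^ 2 * Real.sin y) - (1 - lam) * (Real.sin y - y * Real.cos y) ≤ 0 := by
  have hsx := Real.sin_pos_of_pos_of_lt_pi hx (hxy.trans_lt hy)
  have hsy := Real.sin_pos_of_pos_of_lt_pi (hx.trans_le hxy) hy
  have hy0 := hx.trans_le hxy
  have hm := cot_quotient_monotoneOn ⟨hx, hxy.trans_lt hy⟩ ⟨hy0, hy⟩ hxy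
  simp only at hm
  have h1 : lam ≤ (1 - lam) * ((Real.sin x - x * Real.cos x) / (x ^ 2 * Real.sin x)) := by
    rw [← mul_div_assoc, le_div_iff₀ (by positivity)]; linarith
  have h2 : lam ≤ (1 - lam) * ((Real.sin y - y * Real.cos y) / (y ^ 2 * Real.sin y)) :=
    h1.trans (mul_le_mul_of_nonneg_left hm (by linarith))
  rw [← mul_div_assoc, le_div_iff₀ (by positivity)] at h2
  linarith

theorem IsThetaOne.cos_neg {θ : ℝ} (h : IsThetaOne θ) : Real.cos θ < 0 := by
  have h1 := h.two_pi_div_three_lt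
  have h2 := h.1.2
  exact Real.cos_neg_of_pi_div_two_lt_of_lt (by linarith [Real.pi_pos]) (by linarith)

theorem IsThetaOne.slopeFun_eq_zero {θ : ℝ} (h : IsThetaOne θ) :
    (1 + (1 + Real.cos θ)) * (θ * Real.sin θ) - (1 + Real.cos θ) * (θ ^ 2 * Real.cos θ)
      - 2 * (1 - Real.cos θ) = 0 := by
  linear_combination 2 * h.2 + θ * Real.cos θ * h.sin_eq

/-- The function vanishes at 0 and θ. A negative value between them would, by the mean value
theorem, make its derivative negative and later positive, against `slope_deriv_sign`. -/
theorem IsThetaOne.slopeFun_nonneg {θ x : ℝ} (h : IsThetaOne θ) (hx : 0 < x) (hxθ : x < θ) :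
    0 ≤ (1 + (1 + Real.cos θ)) * (x * Real.sin x) - (1 + Real.cos θ) * (x ^ 2 * Real.cos x)
      - 2 * (1 - Real.cos x) := by
  by_contra! hneg
  have hd := hasDerivAt_slopeFun (1 + Real.cos θ)
  have hc : Continuous (fun x => (1 + (1 + Real.cos θ)) * (x * Real.sin x)
      - (1 + Real.cos θ) * (x ^ 2 * Real.cos x) - 2 * (1 - Real.cos x)) := by fun_prop
  obtain ⟨ξ, hξ, e1⟩ := exists_hasDerivAt_eq_slope _ _ hx hc.continuousOn fun y _ => hd y
  obtain ⟨η, hη, e2⟩ := exists_hasDerivAt_eq_slope _ _ hxθ hc.continuousOn fun y _ => hd y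
  have n1 := slope_deriv_sign (lam := 1 + Real.cos θ) (by linarith [h.cos_neg]) hξ.1
    (hξ.2.trans hη.1).le (hη.2.trans h.1.2) (by
      rw [e1]
      exact div_nonpos_of_nonpos_of_nonneg (by simpa using hneg.le) (by linarith))
  rw [e2, h.slopeFun_eq_zero] at n1
  exact absurd n1 (not_le.2 (div_pos (by linarith) (by linarith)))

theorem IsThetaOne.slopeFun_nonpos {θ x : ℝ} (h : IsThetaOne θ) (hxθ : θ < x) (hx : x < Real.pi) :
    (1 + (1 + Real.cos θ)) * (x * Real.sin x) - (1 + Real.cos θ) * (x ^ 2 * Real.cos x)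
      - 2 * (1 - Real.cos x) ≤ 0 := by
  by_contra! hpos
  have hd := hasDerivAt_slopeFun (1 + Real.cos θ)
  have hc : Continuous (fun x => (1 + (1 + Real.cos θ)) * (x * Real.sin x)
      - (1 + Real.cos θ) * (x ^ 2 * Real.cos x) - 2 * (1 - Real.cos x)) := by fun_prop
  obtain ⟨ξ, hξ, e1⟩ := exists_hasDerivAt_eq_slope _ _ h.1.1 hc.continuousOn fun y _ => hd y
  obtain ⟨η, hη, e2⟩ := exists_hasDerivAt_eq_slope _ _ hxθ hc.continuousOn fun y _ => hd y
  have n1 := slope_deriv_sign (lam := 1 + Real.cos θ) (by linarith [h.cos_neg]) hξ.1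
    (hξ.2.trans hη.1).le (hη.2.trans hx) (by
      rw [e1, h.slopeFun_eq_zero]
      simp)
  rw [e2, h.slopeFun_eq_zero] at n1
  exact absurd n1 (not_le.2 (div_pos (by linarith) (by linarith)))

theorem hasDerivAt_radiusFun (lam : ℝ) {x : ℝ} (hx : x ≠ 0) :
    HasDerivAt (fun x => (2 * (1 - Real.cos x) - 2 * lam * x * Real.sin x) / x ^ 2)
      (2 * ((1 + lam) * (x * Real.sin x) - lam * (x ^ 2 * Real.cos x)
        - 2 * (1 - Real.cos x)) / x ^ 3) x := by
  convert! ((((Real.hasDerivAt_cos x).const_sub 1).const_mul 2).sub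
    (((hasDerivAt_id x).const_mul (2 * lam)).mul (Real.hasDerivAt_sin x))).div
    ((hasDerivAt_id x).pow 2) (pow_ne_zero 2 hx) using 1
  simp only [id, Pi.pow_apply, Pi.mul_apply, Pi.sub_apply]
  field_simp
  norm_num
  ring

/-- Dividing by `x²` leaves a quotient whose derivative has the sign of the slope function, so on
`(0, π]` it peaks at θ, where the value is exactly the claimed constant. -/
theorem IsThetaOne.radiusFun_le {θ x : ℝ} (h : IsThetaOne θ) (hx : 0 < x) (hxp : x ≤ Real.pi) :
    2 * (1 - Real.cos x) - 2 * (1 + Real.cos θ) * x * Real.sin x ≤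
      2 * (1 + Real.cos θ) * (1 - (1 + Real.cos θ)) * x ^ 2 := by
  have hd := fun {y : ℝ} (hy : 0 < y) => hasDerivAt_radiusFun (1 + Real.cos θ) hy.ne'
  have hθ0 := h.1.1
  have hval : (2 * (1 - Real.cos θ) - 2 * (1 + Real.cos θ) * θ * Real.sin θ) / θ ^ 2 =
      2 * (1 + Real.cos θ) * (1 - (1 + Real.cos θ)) := by
    rw [div_eq_iff (by positivity)]
    linear_combination -2 * h.2 - 2 * θ * Real.cos θ * h.sin_eq
  rw [← div_le_iff₀ (by positivity), ← hval]
  rcases le_total x θ with hxθ | hxθ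
  · have hm : MonotoneOn (fun x => (2 * (1 - Real.cos x) - 2 * (1 + Real.cos θ) * x * Real.sin x)
        / x ^ 2) (Set.Ioc 0 θ) := by
      refine monotoneOn_of_deriv_nonneg (convex_Ioc _ _)
        (fun y hy => (hd hy.1).continuousAt.continuousWithinAt)
        (fun y hy => ?_) (fun y hy => ?_)
      · rw [interior_Ioc] at hy
        exact (hd hy.1).differentiableAt.differentiableWithinAt
      · rw [interior_Ioc] at hy
        rw [(hd hy.1).deriv]
        have := hy.1
        exact div_nonneg (mul_nonneg two_pos.le (h.slopeFun_nonneg hy.1 hy.2)) (by positivity)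
    exact hm ⟨hx, hxθ⟩ ⟨hθ0, le_rfl⟩ hxθ
  · have hm : AntitoneOn (fun x => (2 * (1 - Real.cos x) - 2 * (1 + Real.cos θ) * x * Real.sin x)
        / x ^ 2) (Set.Icc θ Real.pi) := by
      refine antitoneOn_of_deriv_nonpos (convex_Icc _ _)
        (fun y hy => (hd (hθ0.trans_le hy.1)).continuousAt.continuousWithinAt)
        (fun y hy => ?_) (fun y hy => ?_)
      · rw [interior_Icc] at hy
        exact (hd (hθ0.trans hy.1)).differentiableAt.differentiableWithinAt
      · rw [interior_Icc] at hy
        rw [(hd (hθ0.trans hy.1)).deriv]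
        have := hθ0.trans hy.1
        exact div_nonpos_of_nonpos_of_nonneg
          (mul_nonpos_of_nonneg_of_nonpos two_pos.le (h.slopeFun_nonpos hy.1 hy.2)) (by positivity)
    exact hm ⟨le_rfl, h.1.2.le⟩ ⟨hxθ, hxp⟩ hxθ

theorem IsThetaOne.one_add_cos_bounds {θ : ℝ} (h : IsThetaOne θ) :
    0.18 < 1 + Real.cos θ ∧ 1 + Real.cos θ < 0.375 := by
  have h1 := h.two_pi_div_three_lt
  have h2 := h.1.2
  have h3 := h.one_add_cos_mul
  have hpi := Real.pi_gt_d2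
  have hpi' := Real.pi_lt_d2
  have h4 : 4.36 < θ ^ 2 := by nlinarith
  have h5 : θ ^ 2 < 9.93 := by nlinarith
  constructor <;> nlinarith

/-- On `[π, 2π]` the difference of the sides grows from its nonnegative value at `π`, because `sin ≤
0` and `2(1 - lam) > 1`. Beyond `2π` the numerical bounds on `lam` leave ample room. -/
theorem IsThetaOne.radiusFun_le_of_pi_le {θ x : ℝ} (h : IsThetaOne θ) (hx : Real.pi ≤ x) :
    2 * (1 - Real.cos x) - 2 * (1 + Real.cos θ) * x * Real.sin x ≤
      2 * (1 + Real.cos θ) * (1 - (1 + Real.cos θ)) * x ^ 2 := by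
  obtain ⟨hl1, hl2⟩ := h.one_add_cos_bounds
  have hπ := h.radiusFun_le Real.pi_pos le_rfl
  generalize 1 + Real.cos θ = lam at *
  have hpi := Real.pi_gt_d2
  rcases le_total x (2 * Real.pi) with hx2 | hx2
  · have hd (y : ℝ) : HasDerivAt (fun x => 2 * lam * (1 - lam) * x ^ 2 + 2 * lam * (x * Real.sin x)
        - 2 * (1 - Real.cos x))
        (4 * lam * (1 - lam) * y + 2 * lam * (y * Real.cos y) - 2 * (1 - lam) * Real.sin y) y := by
      convert! ((((hasDerivAt_id y).pow 2).const_mul (2 * lam * (1 - lam))).add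
        (((hasDerivAt_id y).mul (Real.hasDerivAt_sin y)).const_mul (2 * lam))).sub
        (((Real.hasDerivAt_cos y).const_sub 1).const_mul 2) using 1
      simp only [id]
      norm_num
      ring
    have hm : MonotoneOn (fun x => 2 * lam * (1 - lam) * x ^ 2 + 2 * lam * (x * Real.sin x)
        - 2 * (1 - Real.cos x)) (Set.Icc Real.pi (2 * Real.pi)) := by
      refine monotoneOn_of_deriv_nonneg (convex_Icc _ _)
        (fun y _ => (hd y).continuousAt.continuousWithinAt)
        (fun y _ => (hd y).differentiableAt.differentiableWithinAt) (fun y hy => ?_)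
      rw [interior_Icc] at hy
      rw [(hd y).deriv]
      have hs : Real.sin y ≤ 0 := by
        have := Real.sin_nonneg_of_nonneg_of_le_pi (x := y - Real.pi) (by linarith [hy.1])
          (by linarith [hy.2])
        rw [Real.sin_sub_pi] at this
        linarith
      have hy0 : 0 < y := by linarith [hy.1]
      have h1 : 0 ≤ lam * y * (2 * (1 - lam) + Real.cos y) :=
        mul_nonneg (by positivity) (by linarith [Real.neg_one_le_cos y])
      nlinarith [mul_nonneg (by linarith : 0 ≤ 1 - lam) (neg_nonneg.2 hs)]
    have := hm ⟨le_rfl, by linarith⟩ ⟨hx, hx2⟩ hx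
    simp only at this
    linarith
  · have hx0 : 6.28 < x := by linarith
    have hs := Real.neg_one_le_sin x
    have hc := Real.neg_one_le_cos x
    have h1 : 1.1304 < lam * x := by nlinarith
    have h2 : 3.8 < (1 - lam) * x := by nlinarith
    nlinarith [mul_nonneg (by linarith : 0 ≤ lam * x) (by linarith : 0 ≤ 1 + Real.sin x),
      mul_lt_mul_of_pos_left h2 (by linarith : 0 < lam * x)]

theorem IsThetaOne.norm_expRem_one_le {θ : ℝ} (h : IsThetaOne θ) (x : ℝ) :
    ‖expRem 1 (1 + Real.cos θ) x‖ ≤ θ⁻¹ * (1 - Real.cos θ) * |x| := by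
  rw [h.inv_mul_eq_sin]
  have hpos : ∀ y : ℝ, 0 ≤ y → ‖expRem 1 (1 + Real.cos θ) y‖ ≤ Real.sin θ * y := by
    intro y hy
    -- Here `k = sin²θ - lam²`, and `sin²θ = lam (2 - lam)` for `lam = 1 + cos θ`.
    refine _root_.norm_expRem_one_le (k := 2 * (1 + Real.cos θ) * (1 - (1 + Real.cos θ)))
      h.sin_pos.le hy (by linear_combination -Real.sin_sq_add_cos_sq θ) ?_
    rcases hy.eq_or_lt with rfl | hy
    · simp
    rcases le_total y Real.pi with hyp | hyp
    · exact h.radiusFun_le hy hyp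
    · exact h.radiusFun_le_of_pi_le hyp
  rcases le_total 0 x with hx | hx
  · rw [abs_of_nonneg hx]; exact hpos x hx
  · rw [abs_of_nonpos hx, ← norm_expRem_neg]; exact hpos _ (by linarith)

/-! ### The interval of admissible `lam` and the functions `gammaFun` -/

theorem qFun_zero {n : ℕ} (hn : 1 ≤ n) : qFun n 0 = 1 :=
  le_antisymm (by simpa using qFun_le_one_sub hn (s := 0) (by norm_num))
    (by simpa using one_sub_le_qFun n 0)

/-- Since `s + q_n(s) ≥ 1` always, with equality at `s = 0`, a supremum of 1 forces equality on the
whole interval. -/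
theorem mem_lamLower_set_iff {n : ℕ} (hn : 1 ≤ n) {lam : ℝ} :
    (0 ≤ lam ∧ sSup ((fun s : ℝ => s + qFun n s) '' Set.Icc 0 lam) = 1) ↔
      0 ≤ lam ∧ ∀ s ∈ Set.Icc 0 lam, qFun n s = 1 - s := by
  refine and_congr_right fun h0 => ⟨fun h s hs => ?_, fun h => ?_⟩
  · have hb : BddAbove ((fun s : ℝ => s + qFun n s) '' Set.Icc 0 lam) :=
      (isCompact_Icc.image (continuous_id.add (continuous_qFun n))).bddAbove
    have := (le_csSup hb ⟨s, hs, rfl⟩).trans_eq h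
    have := one_sub_le_qFun n s
    linarith
  · have : (fun s : ℝ => s + qFun n s) '' Set.Icc 0 lam = {1} := by
      refine Set.eq_singleton_iff_unique_mem.2
        ⟨⟨0, ⟨le_rfl, h0⟩, by simp [qFun_zero hn]⟩, ?_⟩
      rintro _ ⟨s, hs, rfl⟩
      simp [h s hs]
    rw [this, csSup_singleton]

/-- The search can be confined to `[0, 1]`, since `q_n(lam) ≥ lam ≥ 1 = q_n(0)` beyond it. -/
theorem exists_qFun_minimizer {n : ℕ} (hn : 1 ≤ n) :
    ∃ m : ℝ, 0 ≤ m ∧ ∀ lam : ℝ, 0 ≤ lam → qFun n m ≤ qFun n lam := by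
  obtain ⟨m, hm, hmin⟩ := isCompact_Icc.exists_isMinOn (Set.nonempty_Icc.2 (zero_le_one (α := ℝ)))
    (continuous_qFun n).continuousOn
  refine ⟨m, hm.1, fun lam h => ?_⟩
  rcases le_total lam 1 with h1 | h1
  · exact hmin ⟨h, h1⟩
  · have h2 : qFun n m ≤ qFun n 0 := hmin ⟨le_rfl, zero_le_one⟩
    rw [qFun_zero hn] at h2
    exact h2.trans (h1.trans (le_qFun hn lam))

theorem mem_lamUpper_set_iff {n : ℕ} (hn : 1 ≤ n) {m : ℝ} :
    (0 ≤ m ∧ qFun n m = sInf (qFun n '' Set.Ici 0)) ↔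
      0 ≤ m ∧ ∀ lam : ℝ, 0 ≤ lam → qFun n m ≤ qFun n lam := by
  obtain ⟨m₀, hm₀, hmin⟩ := exists_qFun_minimizer hn
  have hl : IsLeast (qFun n '' Set.Ici 0) (qFun n m₀) :=
    ⟨⟨m₀, hm₀, rfl⟩, by rintro _ ⟨lam, h, rfl⟩; exact hmin lam h⟩
  rw [hl.csInf_eq]
  exact and_congr_right fun h0 =>
    ⟨fun h lam hlam => h.trans_le (hmin lam hlam), fun h => (h m₀ hm₀).antisymm (hmin m h0)⟩

theorem lamUpper_spec {n : ℕ} (hn : 1 ≤ n) :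
    0 ≤ lamUpper n ∧ ∀ lam : ℝ, 0 ≤ lam → qFun n (lamUpper n) ≤ qFun n lam := by
  rw [← mem_lamUpper_set_iff hn]
  have hne : {lam : ℝ | 0 ≤ lam ∧ qFun n lam = sInf (qFun n '' Set.Ici 0)}.Nonempty := by
    obtain ⟨m, hm⟩ := exists_qFun_minimizer hn
    exact ⟨m, (mem_lamUpper_set_iff hn).2 hm⟩
  have hcl : IsClosed {lam : ℝ | 0 ≤ lam ∧ qFun n lam = sInf (qFun n '' Set.Ici 0)} :=
    (isClosed_le continuous_const continuous_id).inter
      (isClosed_eq (continuous_qFun n) continuous_const)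
  exact hcl.csInf_mem hne ⟨0, fun _ h => h.1⟩

/-- Where `q_n(s) = 1 - s` the function is strictly decreasing, so no minimiser lies strictly left
of `lam`. This makes the interval of admissible `lam` nonempty. -/
theorem le_lamUpper {n : ℕ} (hn : 1 ≤ n) {lam : ℝ} (h0 : 0 ≤ lam)
    (h : ∀ s ∈ Set.Icc 0 lam, qFun n s = 1 - s) : lam ≤ lamUpper n := by
  obtain ⟨hu, hmin⟩ := lamUpper_spec hn
  by_contra! hlt
  have := hmin lam h0
  rw [h _ ⟨hu, hlt.le⟩, h _ ⟨h0, le_rfl⟩] at this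
  linarith

theorem quarter_mem_lamLower_set {n : ℕ} (hn : 1 ≤ n) :
    (1 / 4 : ℝ) ∈
      {lam : ℝ | 0 ≤ lam ∧ sSup ((fun s : ℝ => s + qFun n s) '' Set.Icc 0 lam) = 1} :=
  (mem_lamLower_set_iff hn).2 ⟨by norm_num, fun s hs =>
    (qFun_le_one_sub hn hs.2).antisymm (one_sub_le_qFun n s)⟩

theorem bddAbove_lamLower_set {n : ℕ} (hn : 1 ≤ n) :
    BddAbove {lam : ℝ | 0 ≤ lam ∧ sSup ((fun s : ℝ => s + qFun n s) '' Set.Icc 0 lam) = 1} :=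
  ⟨lamUpper n, fun _ h =>
    le_lamUpper hn h.1 ((mem_lamLower_set_iff hn).1 h).2⟩

theorem lamLower_pos {n : ℕ} (hn : 1 ≤ n) : 0 < lamLower n :=
  lt_of_lt_of_le (by norm_num) (le_csSup (bddAbove_lamLower_set hn) (quarter_mem_lamLower_set hn))

theorem lamLower_le_lamUpper {n : ℕ} (hn : 1 ≤ n) : lamLower n ≤ lamUpper n :=
  csSup_le ⟨_, quarter_mem_lamLower_set hn⟩ fun _ h =>
    le_lamUpper hn h.1 ((mem_lamLower_set_iff hn).1 h).2

theorem qFun_lamLower_le {n : ℕ} (hn : 1 ≤ n) : qFun n (lamLower n) ≤ 1 - lamLower n := by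
  have hcl : IsClosed {lam : ℝ | qFun n lam ≤ 1 - lam} :=
    isClosed_le (continuous_qFun n) (by fun_prop)
  refine closure_minimal (fun lam h => ?_) hcl
    (csSup_mem_closure ⟨_, quarter_mem_lamLower_set hn⟩ (bddAbove_lamLower_set hn))
  have h := (mem_lamLower_set_iff hn).1 h
  exact (h.2 lam ⟨h.1, le_rfl⟩).le

/-! ### The functions `γ_n` as minima over a compact interval -/

theorem isLeast_gammaFun {n : ℕ} (hn : 1 ≤ n) (b : ℝ) :
    IsLeast ((fun lam : ℝ => lam * momentA b + qFun n lam) ''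
      Set.Icc (lamLower n) (lamUpper n)) (gammaFun n b) := by
  have hc : Continuous (fun lam : ℝ => lam * momentA b + qFun n lam) :=
    (continuous_id.mul continuous_const).add (continuous_qFun n)
  exact (isCompact_Icc.image hc).isLeast_sInf
    ((Set.nonempty_Icc.2 (lamLower_le_lamUpper hn)).image _)

theorem exists_gammaFun_eq {n : ℕ} (hn : 1 ≤ n) (b : ℝ) :
    ∃ lam, 0 < lam ∧ lam ∈ Set.Icc (lamLower n) (lamUpper n) ∧
      gammaFun n b = lam * momentA b + qFun n lam := by
  obtain ⟨lam, h, e⟩ := (isLeast_gammaFun hn b).1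
  exact ⟨lam, (lamLower_pos hn).trans_le h.1, h, e.symm⟩

theorem gammaFun_le {n : ℕ} (hn : 1 ≤ n) (b : ℝ) {lam : ℝ}
    (h : lam ∈ Set.Icc (lamLower n) (lamUpper n)) :
    gammaFun n b ≤ lam * momentA b + qFun n lam :=
  (isLeast_gammaFun hn b).2 ⟨lam, h, rfl⟩

theorem gammaFun_pos {n : ℕ} (hn : 1 ≤ n) (b : ℝ) : 0 < gammaFun n b := by
  obtain ⟨lam, h0, -, e⟩ := exists_gammaFun_eq hn b
  have h1 := le_qFun hn lam
  have h2 := mul_nonneg h0.le (momentA_nonneg b)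
  linarith

theorem gammaFun_strictMonoOn {n : ℕ} (hn : 1 ≤ n) : StrictMonoOn (gammaFun n) (Set.Ici 1) := by
  intro b hb c hc hbc
  obtain ⟨lam, h0, h, e⟩ := exists_gammaFun_eq hn c
  have h1 := gammaFun_le hn b h
  have h2 := mul_lt_mul_of_pos_left (momentA_strictMonoOn hb hc hbc) h0
  linarith

/-- A minimum over `lam > 0` of functions concave in `b`: the minimiser at the intermediate point is
used as a competitor at both ends. -/
theorem gammaFun_concaveOn {n : ℕ} (hn : 1 ≤ n) : ConcaveOn ℝ (Set.Ici 1) (gammaFun n) := by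
  refine ⟨convex_Ici 1, fun x hx y hy p q hp hq hpq => ?_⟩
  obtain ⟨lam, h0, h, e⟩ := exists_gammaFun_eq hn (p • x + q • y)
  have h1 := mul_le_mul_of_nonneg_left (gammaFun_le hn x h) hp
  have h2 := mul_le_mul_of_nonneg_left (gammaFun_le hn y h) hq
  have h3 := mul_le_mul_of_nonneg_left (momentA_concave.2 hx hy hp hq hpq) h0.le
  rw [e]
  simp only [smul_eq_mul] at *
  obtain rfl : q = 1 - p := by linarith
  linarith

theorem mul_gammaFun_concaveOn {n : ℕ} (hn : 1 ≤ n) :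
    ConcaveOn ℝ (Set.Ici 1) (fun b => b * gammaFun n b) := by
  refine ⟨convex_Ici 1, fun x hx y hy p q hp hq hpq => ?_⟩
  obtain ⟨lam, h0, h, e⟩ := exists_gammaFun_eq hn (p • x + q • y)
  have hx0 : 0 ≤ x := zero_le_one.trans hx
  have hy0 : 0 ≤ y := zero_le_one.trans hy
  have h1 := mul_le_mul_of_nonneg_left (gammaFun_le hn x h) (mul_nonneg hp hx0)
  have h2 := mul_le_mul_of_nonneg_left (gammaFun_le hn y h) (mul_nonneg hq hy0)
  have h3 := mul_le_mul_of_nonneg_left (mul_momentA_concave.2 hx hy hp hq hpq) h0.le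
  simp only [smul_eq_mul] at *
  rw [e]
  linarith

theorem mul_gammaFun_strictMonoOn {n : ℕ} (hn : 1 ≤ n) :
    StrictMonoOn (fun b => b * gammaFun n b) (Set.Ici 1) := fun b hb _ hc hbc =>
  mul_lt_mul hbc (gammaFun_strictMonoOn hn hb hc hbc).le (gammaFun_pos hn b)
    (zero_le_one.trans hc)

theorem gammaFun_one {n : ℕ} (hn : 1 ≤ n) : gammaFun n 1 = qFun n (lamUpper n) := by
  refine le_antisymm ?_ ?_
  · simpa [momentA_one] using
      gammaFun_le hn 1 (Set.right_mem_Icc.2 (lamLower_le_lamUpper hn))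
  · obtain ⟨lam, h0, -, e⟩ := exists_gammaFun_eq hn 1
    rw [e, momentA_one, mul_zero, zero_add]
    exact (lamUpper_spec hn).2 lam h0.le

theorem gammaFun_lt_one {n : ℕ} (hn : 1 ≤ n) {b : ℝ} (hb : 1 ≤ b) : gammaFun n b < 1 := by
  have h1 := gammaFun_le hn b (Set.left_mem_Icc.2 (lamLower_le_lamUpper hn))
  have h2 := qFun_lamLower_le hn
  have h3 := mul_lt_mul_of_pos_left (momentA_lt_one hb) (lamLower_pos hn)
  linarith

/-- From `q_n(lam) ≥ 1 - lam` and `lam ≤ lamUpper n` follows `γ_n(b) ≥ 1 - lamUpper n * (1 - A(b))`,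
which squeezes `γ_n` from below. -/
theorem gammaFun_tendsto {n : ℕ} (hn : 1 ≤ n) :
    Filter.Tendsto (gammaFun n) Filter.atTop (nhds 1) := by
  have hl : Filter.Tendsto (fun b => 1 - lamUpper n * (1 - momentA b)) Filter.atTop (nhds 1) := by
    simpa using ((momentA_tendsto.const_sub 1).const_mul (lamUpper n)).const_sub 1
  refine tendsto_of_tendsto_of_tendsto_of_le_of_le' hl tendsto_const_nhds ?_ ?_
  · filter_upwards [Filter.eventually_ge_atTop 1] with b hb
    obtain ⟨lam, h0, h, e⟩ := exists_gammaFun_eq hn b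
    have h1 := one_sub_le_qFun n lam
    have h2 := mul_le_mul_of_nonneg_right h.2 (sub_nonneg.2 (momentA_lt_one hb).le)
    linarith
  · filter_upwards [Filter.eventually_ge_atTop 1] with b hb
    exact (gammaFun_lt_one hn hb).le

/-! ### Characteristic functions -/

open MeasureTheory

/-- The bound for `|∫ x ^ m * expRem n 0 (t x)|`, with `m + n = 3`. -/
theorem norm_integral_expRem_le {μ : Measure ℝ} [IsProbabilityMeasure μ] {b : ℝ} {m n : ℕ}
    (hn : 1 ≤ n) (hmn : m + n = 3) (h3 : Integrable (fun x => |x| ^ 3) μ)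
    (m3 : ∫ x, |x| ^ 3 ∂μ = b) (hA : |∫ x, x ^ 3 ∂μ| ≤ b * momentA b) (t : ℝ) :
    ‖∫ x, (x : ℂ) ^ m * expRem n 0 (t * x) ∂μ‖ ≤
      b * gammaFun n b * (|t| ^ n / n.factorial) := by
  obtain ⟨lam, h0, -, e⟩ := exists_gammaFun_eq hn b
  have hfac : (0 : ℝ) < n.factorial := by exact_mod_cast n.factorial_pos
  have hcont : Continuous (fun x : ℝ => (x : ℂ) ^ m * expRem n lam (t * x)) := by
    unfold expRem; fun_prop
  have hbound : ∀ x : ℝ, ‖(x : ℂ) ^ m * expRem n lam (t * x)‖ ≤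
      qFun n lam * (|t| ^ n / n.factorial) * |x| ^ 3 := by
    intro x
    rw [norm_mul, norm_pow, Complex.norm_real, Real.norm_eq_abs]
    calc |x| ^ m * ‖expRem n lam (t * x)‖
        ≤ |x| ^ m * (qFun n lam * (|t * x| ^ n / n.factorial)) := by
          gcongr; exact norm_expRem_le_qFun_abs hn lam _
      _ = _ := by rw [← hmn, abs_mul, mul_pow, pow_add]; ring
  have hint : Integrable (fun x : ℝ => (x : ℂ) ^ m * expRem n lam (t * x)) μ :=
    (h3.const_mul _).mono' hcont.aestronglyMeasurable (Filter.Eventually.of_forall hbound)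
  have hx3 : Integrable (fun x : ℝ => x ^ 3) μ := h3.mono' (by fun_prop) (by simp)
  -- The weight `lam` is traded for a multiple of `x ^ 3`, whose integral is controlled by `hA`
  -- rather than by `b`.
  have hsplit : ∀ x : ℝ, (x : ℂ) ^ m * expRem n 0 (t * x) =
      (x : ℂ) ^ m * expRem n lam (t * x) +
        (lam : ℂ) * ((Complex.I * t) ^ n / (n.factorial : ℂ)) * ((x ^ 3 : ℝ) : ℂ) := by
    intro x
    rw [expRem_eq n 0 lam, ← hmn]
    push_cast
    ring
  have hint2 : Integrable (fun x : ℝ => (lam : ℂ) * ((Complex.I * t) ^ n / (n.factorial : ℂ)) *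
      ((x ^ 3 : ℝ) : ℂ)) μ := (hx3.ofReal (𝕜 := ℂ)).const_mul _
  simp only [hsplit]
  rw [integral_add hint hint2, integral_const_mul,
    show ∫ x : ℝ, ((x ^ 3 : ℝ) : ℂ) ∂μ = ((∫ x, x ^ 3 ∂μ : ℝ) : ℂ) from integral_ofReal]
  refine (norm_add_le _ _).trans ?_
  have e1 : ‖∫ x, (x : ℂ) ^ m * expRem n lam (t * x) ∂μ‖ ≤
      qFun n lam * (|t| ^ n / n.factorial) * b := by
    rw [← m3, ← integral_const_mul]
    exact norm_integral_le_of_norm_le (h3.const_mul _) (Filter.Eventually.of_forall hbound)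
  have e2 : ‖(lam : ℂ) * ((Complex.I * t) ^ n / (n.factorial : ℂ)) *
      ((∫ x, x ^ 3 ∂μ : ℝ) : ℂ)‖ ≤ lam * (|t| ^ n / n.factorial) * (b * momentA b) := by
    rw [norm_mul, Complex.norm_real, Real.norm_eq_abs]
    have : ‖(lam : ℂ) * ((Complex.I * t) ^ n / (n.factorial : ℂ))‖ =
        lam * (|t| ^ n / n.factorial) := by simp [abs_of_pos h0]
    rw [this]
    gcongr
  rw [e]
  linarith

theorem integrable_cexp_mul {μ : Measure ℝ} {g : ℝ → ℂ} (hg : Integrable g μ) (t : ℝ) :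
    Integrable (fun x : ℝ => g x * Complex.exp (t * x * Complex.I)) μ := by
  refine hg.norm.mono' (hg.1.mul (by fun_prop)) (Filter.Eventually.of_forall fun x => ?_)
  rw [norm_mul, ← Complex.ofReal_mul, Complex.norm_exp_ofReal_mul_I, mul_one]

section Normalised

variable {μ : Measure ℝ} [IsProbabilityMeasure μ]

/-- The parameter `lam` is free because the linear term integrates to zero. -/
theorem charFun_sub_one_eq (h1 : Integrable (fun x => x) μ) (m1 : ∫ x, x ∂μ = 0) (lam t : ℝ) :
    charFun μ t - 1 = ∫ x, expRem 1 lam (t * x) ∂μ := by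
  have he := integrable_cexp_mul (μ := μ) (integrable_const (1 : ℂ)) t
  simp only [one_mul] at he
  have h1c : Integrable (fun x : ℝ => (x : ℂ)) μ := h1.ofReal
  have m1c : ∫ x : ℝ, (x : ℂ) ∂μ = 0 := by
    rw [show ∫ x : ℝ, (x : ℂ) ∂μ = ((∫ x, x ∂μ : ℝ) : ℂ) from integral_ofReal, m1,
      Complex.ofReal_zero]
  have hx : ∀ x : ℝ, expRem 1 lam (t * x) =
      Complex.exp (t * x * Complex.I) - 1 - lam * Complex.I * t * (x : ℂ) := by
    intro x
    simp only [expRem, Finset.sum_range_one]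
    push_cast
    rw [mul_comm Complex.I]
    simp
    ring
  simp only [hx]
  have he1 : Integrable (fun x : ℝ => Complex.exp (t * x * Complex.I) - 1) μ :=
    he.sub (integrable_const 1)
  rw [integral_sub he1 (h1c.const_mul _),
    integral_sub he (integrable_const 1), integral_const_mul, m1c, charFun_apply_real]
  simp

theorem charFun_eq_integral_expRem_three (h1 : Integrable (fun x => x) μ)
    (h2 : Integrable (fun x => x ^ 2) μ) (m1 : ∫ x, x ∂μ = 0) (m2 : ∫ x, x ^ 2 ∂μ = 1) (t : ℝ) :
    charFun μ t - 1 + (t : ℂ) ^ 2 / 2 = ∫ x, (x : ℂ) ^ 0 * expRem 3 0 (t * x) ∂μ := by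
  have he : Integrable (fun x : ℝ => expRem 1 1 (t * x)) μ := by
    have he := integrable_cexp_mul (μ := μ) (integrable_const (1 : ℂ)) t
    have h1c : Integrable (fun x : ℝ => (x : ℂ)) μ := h1.ofReal
    refine ((he.sub (integrable_const 1)).sub (h1c.const_mul (Complex.I * t))).congr
      (Filter.Eventually.of_forall fun x => ?_)
    simp only [expRem, Finset.sum_range_one, Pi.sub_apply]
    push_cast
    rw [mul_comm Complex.I]
    simp
    ring_nf
  have h2c : Integrable (fun x : ℝ => ((x ^ 2 : ℝ) : ℂ)) μ := h2.ofReal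
  have m2c : ∫ x : ℝ, ((x ^ 2 : ℝ) : ℂ) ∂μ = 1 := by
    rw [show ∫ x : ℝ, ((x ^ 2 : ℝ) : ℂ) ∂μ = ((∫ x, x ^ 2 ∂μ : ℝ) : ℂ) from integral_ofReal, m2,
      Complex.ofReal_one]
  have hx : ∀ x : ℝ, (x : ℂ) ^ 0 * expRem 3 0 (t * x) =
      expRem 1 1 (t * x) + (t : ℂ) ^ 2 / 2 * ((x ^ 2 : ℝ) : ℂ) := by
    intro x
    simp only [expRem, Finset.sum_range_succ, Finset.sum_range_zero, Nat.factorial]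
    push_cast
    linear_combination (-1 / 2 * (t : ℂ) ^ 2 * x ^ 2) * Complex.I_sq
  simp only [hx]
  rw [integral_add he (h2c.const_mul _), integral_const_mul, m2c,
    charFun_sub_one_eq h1 m1 1 t, mul_one]

theorem I_mul_integral_expRem_two {μ : Measure ℝ} (h1 : Integrable (fun x => x) μ)
    (h2 : Integrable (fun x => x ^ 2) μ) (m1 : ∫ x, x ∂μ = 0) (m2 : ∫ x, x ^ 2 ∂μ = 1) (t : ℝ) :
    Complex.I * ∫ x : ℝ, (x : ℂ) * Complex.exp (t * x * Complex.I) ∂μ + t =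
      Complex.I * ∫ x, (x : ℂ) ^ 1 * expRem 2 0 (t * x) ∂μ := by
  have h1c : Integrable (fun x : ℝ => (x : ℂ)) μ := h1.ofReal
  have he := integrable_cexp_mul h1c t
  have h2c : Integrable (fun x : ℝ => ((x ^ 2 : ℝ) : ℂ)) μ := h2.ofReal
  have m1c : ∫ x : ℝ, (x : ℂ) ∂μ = 0 := by
    rw [show ∫ x : ℝ, (x : ℂ) ∂μ = ((∫ x, x ∂μ : ℝ) : ℂ) from integral_ofReal, m1,
      Complex.ofReal_zero]
  have m2c : ∫ x : ℝ, ((x ^ 2 : ℝ) : ℂ) ∂μ = 1 := by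
    rw [show ∫ x : ℝ, ((x ^ 2 : ℝ) : ℂ) ∂μ = ((∫ x, x ^ 2 ∂μ : ℝ) : ℂ) from integral_ofReal, m2,
      Complex.ofReal_one]
  have hx : ∀ x : ℝ, (x : ℂ) ^ 1 * expRem 2 0 (t * x) =
      (x : ℂ) * Complex.exp (t * x * Complex.I) - (x : ℂ)
        - Complex.I * t * ((x ^ 2 : ℝ) : ℂ) := by
    intro x
    simp only [expRem, Finset.sum_range_succ, Finset.sum_range_zero]
    push_cast
    rw [mul_comm Complex.I]
    simp
    ring
  simp only [hx]
  have he1 : Integrable (fun x : ℝ => (x : ℂ) * Complex.exp (t * x * Complex.I) - (x : ℂ)) μ :=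
    he.sub h1c
  rw [integral_sub he1 (h2c.const_mul _), integral_sub he h1c, integral_const_mul,
    m1c, m2c]
  linear_combination (t : ℂ) * Complex.I_sq

theorem integral_expRem_one {μ : Measure ℝ} (h2 : Integrable (fun x => x ^ 2) μ) (m2 : ∫ x, x ^ 2 ∂μ = 1)
    (t : ℝ) :
    Complex.I ^ 2 * ∫ x : ℝ, (x : ℂ) ^ 2 * Complex.exp (t * x * Complex.I) ∂μ + 1 =
      -∫ x, (x : ℂ) ^ 2 * expRem 1 0 (t * x) ∂μ := by
  have h2c : Integrable (fun x : ℝ => (x : ℂ) ^ 2) μ := by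
    simpa using h2.ofReal (𝕜 := ℂ)
  have he := integrable_cexp_mul h2c t
  have m2c : ∫ x : ℝ, (x : ℂ) ^ 2 ∂μ = 1 := by
    have : ∫ x : ℝ, ((x ^ 2 : ℝ) : ℂ) ∂μ = ((∫ x, x ^ 2 ∂μ : ℝ) : ℂ) := integral_ofReal
    simpa [m2] using this
  have hx : ∀ x : ℝ, (x : ℂ) ^ 2 * expRem 1 0 (t * x) =
      (x : ℂ) ^ 2 * Complex.exp (t * x * Complex.I) - (x : ℂ) ^ 2 := by
    intro x
    simp only [expRem, Finset.sum_range_one]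
    push_cast
    rw [mul_comm Complex.I]
    simp
    ring
  simp only [hx]
  rw [integral_sub he h2c, m2c, Complex.I_sq]
  ring

/-- The lower bound is the upper bound for the reflected law. -/
theorem abs_integral_cube_le {b : ℝ} (hb : 1 ≤ b)
    (h1 : Integrable (fun x => x) μ) (h2 : Integrable (fun x => x ^ 2) μ)
    (h3 : Integrable (fun x => |x| ^ 3) μ) (m1 : ∫ x, x ∂μ = 0) (m2 : ∫ x, x ^ 2 ∂μ = 1)
    (m3 : ∫ x, |x| ^ 3 ∂μ = b) : |∫ x, x ^ 3 ∂μ| ≤ b * momentA b := by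
  rw [abs_le']
  refine ⟨integral_cube_le hb h1 h2 h3 m1 m2 m3, ?_⟩
  have hneg : MeasurableEmbedding (fun x : ℝ => -x) := (MeasurableEquiv.neg ℝ).measurableEmbedding
  have : IsProbabilityMeasure (μ.map (fun x => -x)) :=
    Measure.isProbabilityMeasure_map (by fun_prop)
  have := integral_cube_le (μ := μ.map (fun x => -x)) hb
    (by rw [hneg.integrable_map_iff]; exact h1.neg)
    (by rw [hneg.integrable_map_iff]; simpa [Function.comp_def] using h2)
    (by rw [hneg.integrable_map_iff]; simpa [Function.comp_def] using h3)
    (by rw [hneg.integral_map, integral_neg, m1, neg_zero])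
    (by rw [hneg.integral_map]; simpa using m2)
    (by rw [hneg.integral_map]; simpa using m3)
  rw [hneg.integral_map] at this
  simpa [Odd.neg_pow (by decide : Odd 3), integral_neg] using this

theorem charFun_bounds {b : ℝ} (hb : 1 ≤ b)
    (h2 : Integrable (fun x => x ^ 2) μ) (h3 : Integrable (fun x => |x| ^ 3) μ)
    (m1 : ∫ x, x ∂μ = 0) (m2 : ∫ x, x ^ 2 ∂μ = 1) (m3 : ∫ x, |x| ^ 3 ∂μ = b) :
    Differentiable ℝ (charFun μ) ∧ Differentiable ℝ (deriv (charFun μ)) ∧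
    ∀ t : ℝ,
      ‖charFun μ t - 1 + (t : ℂ) ^ 2 / 2‖ ≤ b * gammaFun 3 b * |t| ^ 3 / 6 ∧
      ‖deriv (charFun μ) t + (t : ℂ)‖ ≤ b * gammaFun 2 b * t ^ 2 / 2 ∧
      ‖deriv (deriv (charFun μ)) t + 1‖ ≤ b * gammaFun 1 b * |t| ∧
      ∀ θ : ℝ, IsThetaOne θ →
        ‖charFun μ t - 1‖ ≤ θ⁻¹ * (1 - Real.cos θ) * ∫ x, |t * x| ∂μ := by
  -- Integrability of `x` cannot be read off from a zero integral, which is also the default value;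
  -- it comes from the second moment.
  have hL2 : MemLp (id : ℝ → ℝ) 2 μ := (memLp_two_iff_integrable_sq (by fun_prop)).2 h2
  have hL1 : MemLp (id : ℝ → ℝ) 1 μ := hL2.mono_exponent (by norm_num)
  have h1 : Integrable (fun x : ℝ => x) μ := memLp_one_iff_integrable.1 hL1
  have hA := abs_integral_cube_le hb h1 h2 h3 m1 m2 m3
  have hC : ContDiff ℝ 2 (charFun μ) := contDiff_charFun (n := 2) (by exact_mod_cast hL2)
  have hd1 (t : ℝ) : deriv (charFun μ) t =
      Complex.I * ∫ x : ℝ, (x : ℂ) * Complex.exp (t * x * Complex.I) ∂μ := by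
    have := iteratedDeriv_charFun (μ := μ) (n := 1) (t := t) (by exact_mod_cast hL1)
    simpa [iteratedDeriv_one] using this
  have hd2 (t : ℝ) : deriv (deriv (charFun μ)) t =
      Complex.I ^ 2 * ∫ x : ℝ, (x : ℂ) ^ 2 * Complex.exp (t * x * Complex.I) ∂μ := by
    have := iteratedDeriv_charFun (μ := μ) (n := 2) (t := t) (by exact_mod_cast hL2)
    rwa [iteratedDeriv_succ, iteratedDeriv_one] at this
  refine ⟨hC.differentiable (by norm_num), ?_, fun t => ⟨?_, ?_, ?_, fun θ hθ => ?_⟩⟩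
  · have := hC.differentiable_iteratedDeriv 1 (by norm_num)
    rwa [iteratedDeriv_one] at this
  · rw [charFun_eq_integral_expRem_three h1 h2 m1 m2 t]
    refine (norm_integral_expRem_le (m := 0) (n := 3) (by norm_num) rfl h3 m3 hA t).trans_eq ?_
    rw [show Nat.factorial 3 = 6 from rfl, mul_div_assoc]
    norm_num
  · rw [hd1, I_mul_integral_expRem_two h1 h2 m1 m2 t, norm_mul, Complex.norm_I, one_mul]
    refine (norm_integral_expRem_le (m := 1) (n := 2) (by norm_num) rfl h3 m3 hA t).trans_eq ?_
    rw [show Nat.factorial 2 = 2 from rfl, mul_div_assoc, sq_abs]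
    norm_num
  · rw [hd2, integral_expRem_one h2 m2 t, norm_neg]
    refine (norm_integral_expRem_le (m := 2) (n := 1) le_rfl rfl h3 m3 hA t).trans_eq ?_
    simp
  · rw [charFun_sub_one_eq h1 m1 (1 + Real.cos θ) t, ← integral_const_mul]
    exact norm_integral_le_of_norm_le ((h1.const_mul t).abs.const_mul _)
      (Filter.Eventually.of_forall fun x => hθ.norm_expRem_one_le (t * x))

end Normalised



theorem corollary1 :
    -- the root `θ₁*` exists and is unique
    (∃! θ : ℝ, IsThetaOne θ) ∧
    -- the bounds on the characteristic function `f` of `X` and its derivatives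
    (∀ (b : ℝ), 1 ≤ b →
      ∀ (Ω : Type*) (mΩ : MeasurableSpace Ω) (P : MeasureTheory.Measure Ω)
        (_ : MeasureTheory.IsProbabilityMeasure P) (X : Ω → ℝ), AEMeasurable X P →
        ∫ ω, X ω ∂P = 0 → ∫ ω, X ω ^ 2 ∂P = 1 → ∫ ω, |X ω| ^ 3 ∂P = b →
        ∀ f : ℝ → ℂ, f = MeasureTheory.charFun (P.map X) →
          Differentiable ℝ f ∧ Differentiable ℝ (deriv f) ∧
          ∀ t : ℝ,
            ‖f t - 1 + (t : ℂ) ^ 2 / 2‖ ≤ b * gammaFun 3 b * |t| ^ 3 / 6 ∧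
            ‖deriv f t + (t : ℂ)‖ ≤ b * gammaFun 2 b * t ^ 2 / 2 ∧
            ‖deriv (deriv f) t + 1‖ ≤ b * gammaFun 1 b * |t| ∧
            ∀ θ : ℝ, IsThetaOne θ →
              ‖f t - 1‖ ≤ θ⁻¹ * (1 - Real.cos θ) * ∫ ω, |t * X ω| ∂P ∧
              θ⁻¹ * (1 - Real.cos θ) * ∫ ω, |t * X ω| ∂P ≤ 0.7247 * |t| * ∫ ω, |X ω| ∂P) ∧
    -- the properties of the functions `γ_n`
    (∀ n : ℕ, n = 1 ∨ n = 2 ∨ n = 3 →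
      (∀ b : ℝ, 1 ≤ b →
        IsLeast ((fun lam : ℝ => lam * momentA b + qFun n lam) ''
          Set.Icc (lamLower n) (lamUpper n)) (gammaFun n b)) ∧
      ConcaveOn ℝ (Set.Ici 1) (gammaFun n) ∧
      StrictMonoOn (gammaFun n) (Set.Ici 1) ∧
      ConcaveOn ℝ (Set.Ici 1) (fun b => b * gammaFun n b) ∧
      StrictMonoOn (fun b => b * gammaFun n b) (Set.Ici 1) ∧
      gammaFun n 1 = qFun n (lamUpper n) ∧
      (∀ b : ℝ, 1 ≤ b → gammaFun n 1 ≤ gammaFun n b ∧ gammaFun n b < 1) ∧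
      Filter.Tendsto (gammaFun n) Filter.atTop (nhds 1)) := by

  refine ⟨existsUnique_isThetaOne, ?_, ?_⟩
  · rintro b hb Ω mΩ P hP X hX m1 m2 m3 f rfl
    have hμ : IsProbabilityMeasure (P.map X) := Measure.isProbabilityMeasure_map hX
    -- The integral of a non-integrable function is 0 by convention, so the nonzero second and third
    -- absolute moments imply integrability.
    have h2 : Integrable (fun ω => X ω ^ 2) P := by
      by_contra h
      rw [integral_undef h] at m2
      exact zero_ne_one m2
    have h3 : Integrable (fun ω => |X ω| ^ 3) P := by
      by_contra h
      rw [integral_undef h] at m3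
      linarith
    obtain ⟨d1, d2, hB⟩ := charFun_bounds (μ := P.map X) hb
      (by rw [integrable_map_measure (by fun_prop) hX]; exact h2)
      (by rw [integrable_map_measure (by fun_prop) hX]; exact h3)
      (by rw [integral_map hX (by fun_prop)]; exact m1)
      (by rw [integral_map hX (by fun_prop)]; exact m2)
      (by rw [integral_map hX (by fun_prop)]; exact m3)
    refine ⟨d1, d2, fun t => ?_⟩
    obtain ⟨b3, b2, b1, b0⟩ := hB t
    refine ⟨b3, b2, b1, fun θ hθ => ⟨?_, ?_⟩⟩
    · have := b0 θ hθ
      rwa [integral_map hX (by fun_prop)] at this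
    · simp only [abs_mul, integral_const_mul]
      rw [mul_assoc 0.7247]
      exact mul_le_mul_of_nonneg_right (sin_le_of_isThetaOne hθ)
        (mul_nonneg (abs_nonneg t) (integral_nonneg fun _ => abs_nonneg _))
  · intro n hn
    have hn : 1 ≤ n := by omega
    exact ⟨fun b _ => isLeast_gammaFun hn b, gammaFun_concaveOn hn, gammaFun_strictMonoOn hn,
      mul_gammaFun_concaveOn hn, mul_gammaFun_strictMonoOn hn, gammaFun_one hn,
      fun b hb => ⟨(gammaFun_strictMonoOn hn).monotoneOn Set.self_mem_Ici hb hb,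
        gammaFun_lt_one hn hb⟩, gammaFun_tendsto hn⟩
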